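/- Let $G=(V,E)$ be a finite connected undirected planar graph with a fixed planar embedding and positive real edge capacities $c$ (in particular, $c\equiv 1$ is allowed), and let $s\neq t$ be two vertices of $G$. Let $G^*$ be the dual multigraph: its vertices are the faces of $G$, and each edge $e$ of $G$ gives a dual edge $e^*$ of length $c(e)$ joining the faces on the two sides of $e$; the vertices $s,t$ of $G$ correspond to faces $s^*,t^*$ of $G^*$. An *$st$-separating cycle* is a simple cycle of $G^*$ (loops and pairs of parallel edges included) that separates $s^*$ from $t^*$, i.e. such that $s$ and $t$ are not connected in $G$ after deleting the edges of $G$ dual to the edges of the cycle; it is *minimum* if its length is least among all $st$-separating cycles. Let $f_s^*$ be a face of $G$ incident with $s$ and $f_t^*$ a face of $G$ incident with $t$, and let $\pi$ be a shortest path in $G^*$ from $f_s^*$ to $f_t^*$. Prolong $\pi$ at its ends by a dummy edge from $f_s^*$ into $s^*$, drawn through a corner of $f_s^*$ at $s$, and a dummy edge from $f_t^*$ into $t^*$, drawn through a corner of $f_t^*$ at $t$; then every end, at a vertex of $\pi$, of an edge not on $\pi$ lies either to the left or to the right of $\pi$. A *crossing* of a cycle $C$ with $\pi$ is a stretch of $C$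 that arrives at a vertex of $\pi$ along an edge not on $\pi$ from one side of $\pi$, then follows zero or more edges of $\pi$, and then leaves $\pi$ along an edge not on $\pi$ to the other side. Then, for every choice of $f_s^*$, $f_t^*$, the corners and $\pi$, every edge of $G^*$ that lies on some minimum $st$-separating cycle also lies on some minimum $st$-separating cycle that crosses $\pi$ exactly once. -/

import Mathlib

/-- An embedding of a connected finite graph with at least one edge in the sphere (plane), given by its rotation system:
`rot d` is the dart (oriented edge) that follows `d` in counterclockwise order around the common
initial vertex, and Euler's formula holds.  The faces are the orbits of `d ↦ rot⁻¹ (reverse of d)`,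
the permutation that walks along the boundary of the face to the left of `d`. -/
structure PlaneEmbedding {V : Type*} (G : SimpleGraph V) where
  rot : Equiv.Perm G.Dart
  fst_rot : ∀ d, (rot d).fst = d.fst
  sameCycle_of_fst_eq : ∀ d d' : G.Dart, d.fst = d'.fst → rot.SameCycle d d'
  euler : Nat.card V +
      Nat.card (Quotient (Equiv.Perm.SameCycle.setoid
        ((Function.Involutive.toPerm _ (SimpleGraph.Dart.symm_involutive (G := G))).trans rot⁻¹)))
    = Nat.card G.edgeSet + 2

namespace PlaneEmbedding

variable {V : Type*} {G : SimpleGraph V} (M : PlaneEmbedding G)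

/-- `faceNext d = rot⁻¹ d.symm`: the dart after `d` on the boundary of the face to the left of `d`.

Darts also serve as the darts of the dual graph: the dart `d` of `G` stands for the dual edge that
crosses `d`, directed from the face on the left of `d` to the face on the right of `d`; `d.symm`
is the same dual edge directed the other way.  Then `faceNext` lists the dual darts leaving a given
face in counterclockwise order around it. -/
def faceNext : Equiv.Perm G.Dart :=
  (Function.Involutive.toPerm _ (SimpleGraph.Dart.symm_involutive (G := G))).trans M.rot⁻¹

/-- The faces of `G`, that is, the vertices of the dual graph. -/
def Face : Type _ := Quotient (Equiv.Perm.SameCycle.setoid M.faceNext)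

/-- The face to the left of `d`: the tail of the dual dart `d`. -/
def tail (d : G.Dart) : M.Face := Quotient.mk (Equiv.Perm.SameCycle.setoid M.faceNext) d

/-- The face to the right of `d`: the head of the dual dart `d`. -/
def head (d : G.Dart) : M.Face := M.tail d.symm

/-- A list of dual darts is a walk from `f` to `g` in the dual graph. -/
def IsDualWalk : M.Face → List G.Dart → M.Face → Prop
  | f, [], g => f = g
  | f, d :: p, g => M.tail d = f ∧ IsDualWalk (M.head d) p g

/-- A path from `f` to `g` in the dual graph: a walk that visits no vertex twice. -/
def IsDualPath (f : M.Face) (p : List G.Dart) (g : M.Face) : Prop :=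
  M.IsDualWalk f p g ∧ (f :: p.map M.head).Nodup

/-- A (simple) cycle in the dual multigraph: a nonempty closed walk without repeated vertices and
without repeated edges.  Cycles of length one (loops) and two (parallel edges) are included. -/
def IsDualCycle (C : List G.Dart) : Prop :=
  C ≠ [] ∧ (∃ f, M.IsDualWalk f C f) ∧ (C.map M.tail).Nodup ∧
    (C.map SimpleGraph.Dart.edge).Nodup

/-- The length of a list of dual darts; a dual edge is as long as the capacity of its edge. -/
def length (_ : PlaneEmbedding G) (c : Sym2 V → ℝ) (p : List G.Dart) : ℝ :=
  (p.map fun d => c d.edge).sum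

/-- `p` is a shortest path from `f` to `g` in the dual graph. -/
def IsShortestDualPath (c : Sym2 V → ℝ) (f : M.Face) (p : List G.Dart) (g : M.Face) : Prop :=
  M.IsDualPath f p g ∧ ∀ q, M.IsDualPath f q g → M.length c p ≤ M.length c q

/-- `C` is a cycle of the dual graph that separates `s` from `t`.  The vertices of `G` are the faces
of the dual graph; two of them lie in the same region of the complement of `C` iff one gets from one
to the other through a sequence of faces, consecutive ones sharing a dual edge not on `C`. -/
def IsSeparatingCycle (s t : V) (C : List G.Dart) : Prop :=
  M.IsDualCycle C ∧
    ¬ (G.deleteEdges {e | e ∈ C.map SimpleGraph.Dart.edge}).Reachable s t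

/-- A separating cycle of minimum length. -/
def IsMinSeparatingCycle (c : Sym2 V → ℝ) (s t : V) (C : List G.Dart) : Prop :=
  M.IsSeparatingCycle s t C ∧ ∀ C', M.IsSeparatingCycle s t C' → M.length c C ≤ M.length c C'

/-- `d` is one of the dual darts met when turning counterclockwise around a face from `x`
(inclusive) up to `y` (exclusive). -/
def InSector (x y d : G.Dart) : Prop :=
  ∃ k : ℕ, (M.faceNext ^ k) x = d ∧ ∀ i ≤ k, (M.faceNext ^ i) x ≠ y

/-! A dart `a` of `G` marks the corner, at the vertex `a.fst`, of the face to the left of `a`.  In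
the counterclockwise order of the dual darts around that face, the dummy edge which joins the face
to `a.fst` through this corner comes immediately before `a`.

Let `p = [p₁, …, pₘ]` be a dual path from the face of the corner `a` to the face of the corner `b`,
prolonged by the dummy edges of these corners at its two ends.  At the `m + 1` vertices of the path
the prolonged path comes in along the dummy edge of `a` (first vertex) or along `pᵢ`, and goes out
along `pᵢ₊₁` or along the dummy edge of `b` (last vertex). -/

/-- The dual dart `d` leaves a vertex of the path `p` to the left of the prolonged path: it is met
when turning counterclockwise from the outgoing to the incoming edge. -/
def LiesLeft (a b : G.Dart) (p : List G.Dart) (d : G.Dart) : Prop :=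
  ∃ xy ∈ (p.map M.faceNext ++ [b]).zip (a :: p.map SimpleGraph.Dart.symm),
    M.InSector xy.1 xy.2 d

/-- The dual dart `d` leaves a vertex of the path `p` to the right of the prolonged path: it is met
when turning counterclockwise from the incoming to the outgoing edge. -/
def LiesRight (a b : G.Dart) (p : List G.Dart) (d : G.Dart) : Prop :=
  ∃ xy ∈ (a :: p.map fun e => M.faceNext e.symm).zip (p ++ [b]), M.InSector xy.1 xy.2 d

/-- `l` is a crossing between the cycle `C` and the path `p` (prolonged at the corners `a`, `b`): a
stretch `e, m₁, …, mₖ, x` (`k ≥ 0`) of consecutive dual darts of the cyclic list `C` that comes to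
the path along `e` from one side, follows edges `m₁, …, mₖ` of the path, and leaves the path along
`x` to the other side. -/
def IsCrossing (a b : G.Dart) (p C l : List G.Dart) : Prop :=
  ∃ (e : G.Dart) (m : List G.Dart) (x : G.Dart), l = e :: (m ++ [x]) ∧ l <:+: C ++ C ∧
    (∀ d ∈ m, d.edge ∈ p.map SimpleGraph.Dart.edge) ∧
    ((M.LiesLeft a b p e.symm ∧ M.LiesRight a b p x) ∨
      (M.LiesRight a b p e.symm ∧ M.LiesLeft a b p x))

/-- The number of crossings between the cycle `C` and the path `p`. -/
noncomputable def crossingNumber (a b : G.Dart) (p C : List G.Dart) : ℕ :=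
  {l | M.IsCrossing a b p C l}.ncard

end PlaneEmbedding

namespace PlaneEmbedding

variable {V : Type*} {G : SimpleGraph V} (M : PlaneEmbedding G)

/-! ### Faces and the duality between dual cycles and cuts -/

/-! The argument is homological, over the field with two elements. The dual darts that leave the
prolonged path `p` to its right trace a walk in `G` from `s` to `t` (`sum_liesRight`). The `parity`
of a dual walk counts, mod 2, how often it crosses that walk.

By Euler's formula every closed dual walk is, mod 2, the cut of some `φ` on the vertices of `G`
(`exists_coboundary_eq`), and its parity is then `φ s + φ t`. So odd closed walks separate `s` from
`t` (`not_reachable_of_parity`). Conversely, separating cycles are odd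
(`IsSeparatingCycle.parity_eq_one`). Splitting at repeated vertices, where positive lengths make
each piece strictly shorter, shows that an odd closed walk no longer than a minimum separating cycle
is itself such a cycle (`IsMinSeparatingCycle.of_parity`). Hence any surgery on a minimum cycle is
allowed if it keeps the parity and does not increase the length.

A minimum cycle is cut at its visits to `p` into segments. A segment is either a single edge of `p`
or an arc that avoids the edges of `p`; an arc is odd exactly when it leaves and rejoins `p` on
different sides. Some arc `A` is odd. If one such arc contains the given edge, the rest of the cycle
is replaced by a stretch of `p`, which is no longer because `p` is shortest
(`IsShortestDualPath.exists_stretch`). Otherwise the edge lies on an even segment `B`; then `A` and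
`B` are kept, and the two pieces between them are replaced by stretches of `p`. In both cases the
result is odd, hence minimum. Its crossings can only occur where it runs along `p` between arcs, and
the parities leave exactly one. -/

theorem faceNext_apply (d : G.Dart) : M.faceNext d = M.rot⁻¹ d.symm := rfl

theorem fst_faceNext (d : G.Dart) : (M.faceNext d).fst = d.snd := by
  have h := M.fst_rot (M.rot⁻¹ d.symm)
  rw [faceNext_apply, ← h]
  simp

theorem tail_eq_tail {d d' : G.Dart} : M.tail d = M.tail d' ↔ M.faceNext.SameCycle d d' := by
  unfold tail
  exact Quotient.eq (r := Equiv.Perm.SameCycle.setoid M.faceNext)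

theorem tail_faceNext (d : G.Dart) : M.tail (M.faceNext d) = M.tail d := by
  rw [tail_eq_tail, Equiv.Perm.sameCycle_apply_left]

theorem tail_surjective : Function.Surjective M.tail := fun f => Quotient.exists_rep f

@[simp] theorem tail_symm (d : G.Dart) : M.tail d.symm = M.head d := rfl

@[simp] theorem head_symm (d : G.Dart) : M.head d.symm = M.tail d := by
  simp [head]

/-- A property of darts that is invariant under reversal and depends only on the face to the left
spreads from one dart to all. -/
theorem dart_induction (hG : G.Connected) {Q : G.Dart → Prop}
    (hsymm : ∀ d, Q d → Q d.symm) (hnext : ∀ d d', M.tail d = M.tail d' → Q d → Q d')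
    (a : G.Dart) (ha : Q a) (d : G.Dart) : Q d := by
  have hrot : ∀ d, Q d ↔ Q (M.rot d) := by
    intro d
    -- `d` follows `(rot d).symm` on the boundary of their common left face, so turning around a
    -- vertex combines a change of dart within a face and a reversal.
    have h1 : M.tail (M.rot d).symm = M.tail d := by
      rw [← M.tail_faceNext (M.rot d).symm, faceNext_apply]
      simp
    constructor
    · intro h
      have := hsymm _ (hnext _ _ h1.symm h)
      rwa [SimpleGraph.Dart.symm_symm] at this
    · intro h
      exact hnext _ _ h1 (hsymm _ h)
  have hcyc : ∀ d d' : G.Dart, d.fst = d'.fst → Q d → Q d' := by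
    intro d d' h hd
    obtain ⟨i, rfl⟩ := M.sameCycle_of_fst_eq d d' h
    clear h
    induction i using Int.induction_on with
    | zero => simpa using hd
    | succ i ih =>
      rw [add_comm, zpow_add, zpow_one, Equiv.Perm.mul_apply]
      exact (hrot _).1 ih
    | pred i ih =>
      rw [sub_eq_add_neg, add_comm, zpow_add, zpow_neg_one, Equiv.Perm.mul_apply, hrot]
      simpa using ih
  have key : ∀ u v, G.Walk u v → (∀ d : G.Dart, d.fst = u → Q d) →
      (∀ d : G.Dart, d.fst = v → Q d) := by
    intro u v w
    induction w with
    | nil => exact id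
    | cons hadj w ih =>
      intro hu
      apply ih
      intro d hd
      exact hcyc (SimpleGraph.Dart.symm ⟨(_, _), hadj⟩) d hd.symm (hsymm _ (hu _ rfl))
  obtain ⟨w⟩ := hG.preconnected a.fst d.fst
  exact key _ _ w (fun d hd => hcyc a d hd.symm ha) d rfl

/-- The edge of `G` crossed by a dual dart. -/
def toEdge (d : G.Dart) : G.edgeSet := ⟨d.edge, d.edge_mem⟩

theorem toEdge_eq_iff {d d' : G.Dart} : toEdge d = toEdge d' ↔ d = d' ∨ d = d'.symm := by
  rw [toEdge, toEdge, Subtype.mk.injEq, SimpleGraph.dart_edge_eq_iff]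

@[simp] theorem toEdge_symm (d : G.Dart) : toEdge d.symm = toEdge d := by
  simp [toEdge]

theorem toEdge_surjective : Function.Surjective (toEdge (G := G)) := by
  rintro ⟨e, he⟩
  induction e using Sym2.ind with
  | _ u v => exact ⟨⟨(u, v), he⟩, rfl⟩

variable (G) in
/-- The cut of a set of vertices, over the field with two elements. -/
def coboundary : (V → ZMod 2) →ₗ[ZMod 2] (G.edgeSet → ZMod 2) where
  toFun φ e := Sym2.lift ⟨fun u v => φ u + φ v, fun _ _ => add_comm _ _⟩ e.1
  map_add' φ ψ := by
    funext ⟨e, he⟩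
    induction e using Sym2.ind with
    | _ u v => simp only [Sym2.lift_mk, Pi.add_apply]; ring
  map_smul' r φ := by
    funext ⟨e, he⟩
    induction e using Sym2.ind with
    | _ u v => simp only [Sym2.lift_mk, Pi.smul_apply, smul_eq_mul, RingHom.id_apply]; ring

theorem coboundary_toEdge (φ : V → ZMod 2) (d : G.Dart) :
    coboundary G φ (toEdge d) = φ d.fst + φ d.snd := rfl

/-! ### Boundaries and cuts mod 2, and their exactness from Euler's formula -/

section Boundary

open scoped Classical

variable [Fintype G.Dart]

/-- The parity of the number of ends of dual edges at each face. -/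
noncomputable def boundary : (G.edgeSet → ZMod 2) →ₗ[ZMod 2] (M.Face → ZMod 2) where
  toFun X f := ∑ d with M.tail d = f, X (toEdge d)
  map_add' X Y := by
    funext f
    simp [Finset.sum_add_distrib]
  map_smul' r X := by
    funext f
    simp [Finset.mul_sum]

theorem boundary_apply (X : G.edgeSet → ZMod 2) (f : M.Face) :
    M.boundary X f = ∑ d with M.tail d = f, X (toEdge d) := rfl

/-- Along the boundary of a face, the end of each dart is the start of the next, so every value of
`φ` is counted twice. -/
theorem boundary_coboundary (φ : V → ZMod 2) : M.boundary (coboundary G φ) = 0 := by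
  funext f
  rw [boundary_apply]
  simp only [coboundary_toEdge, Finset.sum_add_distrib]
  have h : ∑ d with M.tail d = f, φ d.snd = ∑ d with M.tail d = f, φ d.fst := by
    refine Finset.sum_equiv M.faceNext ?_ ?_
    · intro d
      simp [tail_faceNext]
    · intro d _
      rw [fst_faceNext]
  rw [h]
  exact CharTwo.add_self_eq_zero _

/-- The two darts of an edge are counted separately, so both ends of a dual loop contribute. -/
theorem sum_toEdge_eq (Q : G.Dart → Prop) (x : G.Dart) :
    ∑ d with Q d, (Pi.single (toEdge x) 1 : G.edgeSet → ZMod 2) (toEdge d) =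
      (if Q x then 1 else 0) + (if Q x.symm then 1 else 0) := by
  have h : ∀ d : G.Dart, (Pi.single (toEdge x) 1 : G.edgeSet → ZMod 2) (toEdge d) =
      (if d = x then 1 else 0) + (if d = x.symm then 1 else 0) := by
    intro d
    simp only [Pi.single_apply, toEdge_eq_iff]
    have := x.symm_ne
    by_cases h1 : d = x
    · subst h1
      simp [this.symm]
    · simp [h1]
  simp only [h, Finset.sum_add_distrib, Finset.sum_ite_eq', Finset.mem_filter, Finset.mem_univ,
    true_and]

theorem boundary_single (x : G.Dart) :
    M.boundary (Pi.single (toEdge x) 1) = Pi.single (M.tail x) 1 + Pi.single (M.head x) 1 := by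
  funext f
  rw [boundary_apply, sum_toEdge_eq]
  simp [Pi.single_apply, eq_comm]

/-- Every dual cycle, over the field with two elements, is a cut: this is where Euler's formula
is used. -/
theorem exists_coboundary_eq [Finite V] (hG : G.Connected) (a : G.Dart) {X : G.edgeSet → ZMod 2}
    (hX : M.boundary X = 0) : ∃ φ : V → ZMod 2, coboundary G φ = X := by
  have : Fintype V := Fintype.ofFinite V
  have : Fintype M.Face := Fintype.ofSurjective M.tail M.tail_surjective
  have : Fintype G.edgeSet := Fintype.ofSurjective _ toEdge_surjective
  have heuler : Fintype.card V + Fintype.card M.Face = Fintype.card G.edgeSet + 2 := by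
    have := M.euler
    rw [← Nat.card_eq_fintype_card, ← Nat.card_eq_fintype_card, ← Nat.card_eq_fintype_card]
    exact this
  -- Together with the indicator of one face, the boundaries span everything: crossing an edge
  -- changes the indicator of a face by a boundary, and all faces are reached in this way.
  have h1 : Fintype.card M.Face ≤ Module.finrank (ZMod 2) (LinearMap.range M.boundary) + 1 := by
    set N := LinearMap.range M.boundary ⊔ Submodule.span (ZMod 2) {Pi.single (M.tail a) 1} with hN
    have hd : ∀ d, (Pi.single (M.tail d) 1 : M.Face → ZMod 2) ∈ N := by
      refine M.dart_induction hG ?_ ?_ a ?_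
      · intro d hd
        have h2 : M.boundary (Pi.single (toEdge d) 1) ∈ N :=
          le_sup_left (a := LinearMap.range M.boundary) ⟨_, rfl⟩
        rw [boundary_single] at h2
        exact (Submodule.add_mem_iff_right _ hd).1 h2
      · intro d d' h hd
        rwa [← h]
      · exact le_sup_right (a := LinearMap.range M.boundary)
          (Submodule.mem_span_singleton_self _)
    have htop : N = ⊤ := by
      rw [eq_top_iff]
      rintro ψ -
      rw [← Finset.univ_sum_single ψ]
      refine Submodule.sum_mem _ fun f _ => ?_
      obtain ⟨d, rfl⟩ := M.tail_surjective f
      have := N.smul_mem (ψ (M.tail d)) (hd d)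
      rwa [← Pi.single_smul, smul_eq_mul, mul_one] at this
    have h3 : Module.finrank (ZMod 2) N = Fintype.card M.Face := by
      rw [htop, finrank_top, Module.finrank_fintype_fun_eq_card]
    rw [← h3]
    refine (Submodule.finrank_add_le_finrank_add_finrank _ _).trans ?_
    gcongr
    exact (finrank_span_le_card _).trans (by simp)
  -- As `G` is connected, only constant functions have an empty cut.
  have h2 : Fintype.card V ≤ Module.finrank (ZMod 2) (LinearMap.range (coboundary G)) + 1 := by
    have h3 : LinearMap.ker (coboundary G) ≤ Submodule.span (ZMod 2) {fun _ => 1} := by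
      intro φ hφ
      rw [LinearMap.mem_ker] at hφ
      have hadj : ∀ u v, G.Adj u v → φ u = φ v := by
        intro u v h
        have := congrFun hφ (toEdge ⟨(u, v), h⟩)
        rw [coboundary_toEdge] at this
        exact CharTwo.add_eq_zero.1 this
      have hw : ∀ u v, G.Walk u v → φ u = φ v := by
        intro u v w
        induction w with
        | nil => rfl
        | cons h w ih => exact (hadj _ _ h).trans ih
      rw [Submodule.mem_span_singleton]
      refine ⟨φ a.fst, ?_⟩
      funext v
      obtain ⟨w⟩ := hG.preconnected a.fst v
      simp [hw _ _ w]
    have h4 := Submodule.finrank_mono h3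
    have h5 := LinearMap.finrank_range_add_finrank_ker (coboundary G)
    rw [Module.finrank_fintype_fun_eq_card] at h5
    have h6 : Module.finrank (ZMod 2) (Submodule.span (ZMod 2) {(fun _ => 1 : V → ZMod 2)}) ≤ 1 :=
      (finrank_span_le_card _).trans (by simp)
    omega
  have hle : LinearMap.range (coboundary G) ≤ LinearMap.ker M.boundary := by
    rintro _ ⟨φ, rfl⟩
    exact M.boundary_coboundary φ
  have h3 := LinearMap.finrank_range_add_finrank_ker M.boundary
  rw [Module.finrank_fintype_fun_eq_card] at h3
  -- Cuts have rank at least `|V| - 1`, cycles at most `|E| - |F| + 1`; Euler's formula makes these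
  -- numbers equal.
  have heq := Submodule.eq_of_le_of_finrank_le hle (by omega)
  have : X ∈ LinearMap.range (coboundary G) := by
    rw [heq]
    exact hX
  exact this

end Boundary

end PlaneEmbedding

namespace PlaneEmbedding

variable {V : Type*} {G : SimpleGraph V} (M : PlaneEmbedding G)

/-! ### Sectors and the two sides of a dual path -/

theorem tail_faceNext_pow (k : ℕ) (d : G.Dart) : M.tail ((M.faceNext ^ k) d) = M.tail d := by
  induction k with
  | zero => simp
  | succ k ih => rw [pow_succ', Equiv.Perm.mul_apply, tail_faceNext, ih]

/-- The cyclic list of the darts around a face, starting from a given one. -/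
theorem exists_faceNext_period [Finite G.Dart] (x : G.Dart) :
    ∃ N : ℕ, 0 < N ∧ (M.faceNext ^ N) x = x ∧
      (∀ i j, i < j → j < i + N → (M.faceNext ^ i) x ≠ (M.faceNext ^ j) x) ∧
      ∀ d, M.tail d = M.tail x → ∃ k < N, (M.faceNext ^ k) x = d := by
  have hpow : ∀ k, (M.faceNext ^ k) x = M.faceNext^[k] x := fun k => by
    rw [Equiv.Perm.iterate_eq_pow]
  have hper : x ∈ Function.periodicPts M.faceNext := by
    obtain ⟨n, hn, h⟩ := (isOfFinOrder_of_finite M.faceNext).exists_pow_eq_one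
    exact ⟨n, hn, by rw [Function.IsPeriodicPt, Function.IsFixedPt, ← hpow, h]; rfl⟩
  have hpos := Function.minimalPeriod_pos_of_mem_periodicPts hper
  refine ⟨Function.minimalPeriod M.faceNext x, hpos, ?_, ?_, ?_⟩
  · rw [hpow]
    exact Function.iterate_minimalPeriod
  · intro i j hij hj h
    have h2 : (M.faceNext ^ (j - i)) x = x := by
      apply (M.faceNext ^ i).injective
      rw [← Equiv.Perm.mul_apply, ← pow_add, h]
      congr 2
      omega
    rw [hpow] at h2
    have := Function.IsPeriodicPt.minimalPeriod_le (f := M.faceNext) (n := j - i) (by omega) h2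
    omega
  · intro d hd
    obtain ⟨n, hn⟩ := ((M.tail_eq_tail.1 hd).symm).exists_nat_pow_eq
    refine ⟨n % Function.minimalPeriod M.faceNext x, Nat.mod_lt _ hpos, ?_⟩
    rw [hpow, Function.iterate_mod_minimalPeriod_eq, ← hpow, hn]

/-- Numbering the darts around a face turns sectors into intervals of exponents, as long as the
sector is less than a full turn. -/
theorem inSector_pow_iff {x d : G.Dart} {N i m : ℕ}
    (hN : ∀ i j, i < j → j < i + N → (M.faceNext ^ i) x ≠ (M.faceNext ^ j) x)
    (him : i ≤ m) (hm : m < i + N) :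
    M.InSector ((M.faceNext ^ i) x) ((M.faceNext ^ m) x) d ↔
      ∃ k, i ≤ k ∧ k < m ∧ (M.faceNext ^ k) x = d := by
  have hadd : ∀ l, (M.faceNext ^ l) ((M.faceNext ^ i) x) = (M.faceNext ^ (i + l)) x := fun l => by
    rw [← Equiv.Perm.mul_apply, ← pow_add, add_comm]
  constructor
  · rintro ⟨l, hl, hne⟩
    refine ⟨i + l, by omega, ?_, by rw [← hadd, hl]⟩
    by_contra hcon
    apply hne (m - i) (by omega)
    rw [hadd]
    congr 2
    omega
  · rintro ⟨k, hik, hkm, hk⟩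
    refine ⟨k - i, ?_, ?_⟩
    · rw [hadd, ← hk]
      congr 2
      omega
    · intro l hl
      rw [hadd]
      exact hN _ _ (by omega) (by omega)

theorem InSector.tail_eq {M : PlaneEmbedding G} {x y d : G.Dart} (h : M.InSector x y d) :
    M.tail d = M.tail x := by
  obtain ⟨k, rfl, -⟩ := h
  exact M.tail_faceNext_pow k x

theorem not_inSector_right (x y : G.Dart) : ¬ M.InSector x y y := by
  rintro ⟨k, hk, h⟩
  exact h k le_rfl hk

/-- A sector that starts just after `z` would have to make a full turn to reach `z`, and it meets
`w` no later than that. -/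
theorem not_inSector_faceNext [Finite G.Dart] {z w : G.Dart} (h : M.tail w = M.tail z) :
    ¬ M.InSector (M.faceNext z) w z := by
  obtain ⟨N, hN0, hNx, hN, hex⟩ := M.exists_faceNext_period z
  obtain ⟨k, hk, rfl⟩ := hex w h
  have key : ∀ m, 1 ≤ m → m < 1 + N → ¬ M.InSector (M.faceNext z) ((M.faceNext ^ m) z) z := by
    intro m h1 h2 h3
    have h4 := (M.inSector_pow_iff hN h1 h2 (d := z)).1 (by simpa using h3)
    obtain ⟨k, hk1, hk2, hk⟩ := h4
    exact hN 0 k (by omega) (by omega) (by simp [hk])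
  rcases Nat.eq_zero_or_pos k with rfl | hk0
  -- Here `w = z`, which the turn starting after `z` reaches at exponent `N`, not `0`.
  · have := key N (by omega) (by omega)
    rw [hNx] at this
    simpa using this
  · exact key k hk0 (by omega)

/-- The two sectors cut out at a face by an incoming and an outgoing (real or dummy) edge are
complementary. -/
theorem inSector_iff_not_inSector [Finite G.Dart] {aR aL yR yL d : G.Dart}
    (haL : M.tail aL = M.tail d) (hyR : M.tail yR = M.tail d)
    (h : (aR = aL ∧ yL = yR ∧ aL ≠ yR) ∨ (aR = aL ∧ yL = M.faceNext yR ∧ d ≠ yR) ∨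
      (aR = M.faceNext aL ∧ d ≠ aL ∧ yL = yR) ∨
      (aR = M.faceNext aL ∧ d ≠ aL ∧ yL = M.faceNext yR ∧ d ≠ yR ∧ aL ≠ yR)) :
    M.InSector yL aL d ↔ ¬ M.InSector aR yR d := by
  have haR : M.tail d = M.tail aR := by
    rcases h with h | h | h | h <;> rw [h.1, ← haL]
    all_goals rw [tail_faceNext]
  obtain ⟨N, hN0, hNx, hN, hex⟩ := M.exists_faceNext_period aR
  obtain ⟨j, hj, rfl⟩ := hex yR (hyR.trans haR)
  obtain ⟨k, hk, rfl⟩ := hex d haR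
  have hinj : ∀ i < N, ∀ l < N, (M.faceNext ^ i) aR = (M.faceNext ^ l) aR → i = l := by
    intro i hi l hl h
    rcases lt_trichotomy i l with h1 | h1 | h1
    · exact absurd h (hN _ _ h1 (by omega))
    · exact h1
    · exact absurd h.symm (hN _ _ h1 (by omega))
  have hsec : ∀ i m, i ≤ m → m < i + N → m ≤ N →
      (M.InSector ((M.faceNext ^ i) aR) ((M.faceNext ^ m) aR) ((M.faceNext ^ k) aR) ↔
        i ≤ k ∧ k < m) := by
    intro i m h1 h2 h3
    rw [M.inSector_pow_iff hN h1 h2]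
    constructor
    · rintro ⟨l, hl1, hl2, hl⟩
      have := hinj l (by omega) k hk hl
      omega
    · rintro ⟨h4, h5⟩
      exact ⟨k, h4, h5, rfl⟩
  have hright := hsec 0 j (by omega) (by omega) (by omega)
  rw [pow_zero, Equiv.Perm.one_apply] at hright
  have hsucc : ∀ i, M.faceNext ((M.faceNext ^ i) aR) = (M.faceNext ^ (i + 1)) aR := fun i => by
    rw [pow_succ', Equiv.Perm.mul_apply]
  have hlast : ∀ z, aR = M.faceNext z → z = (M.faceNext ^ (N - 1)) aR := by
    intro z hz
    apply M.faceNext.injective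
    rw [hsucc, ← hz, Nat.sub_add_cancel hN0, hNx]
  rw [hright]
  -- The cases are: both edges dummy, only the incoming one, only the outgoing one, none. A dummy
  -- edge lies between two darts, so both sectors are bounded by the same dart; a real edge belongs
  -- to neither sector, whence the shift by `faceNext`. The right sector starts at exponent `0`; the
  -- left one ends at `N`, or at `N - 1` if the incoming edge is real.
  rcases h with ⟨h1, rfl, h2⟩ | ⟨h1, rfl, h2⟩ | ⟨h1, h2, rfl⟩ | ⟨h1, h2, rfl, h3, h4⟩
  · have hj0 : j ≠ 0 := by
      rintro rfl
      exact h2 h1.symm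
    have := hsec j N (by omega) (by omega) le_rfl
    rw [hNx, h1] at this
    rw [h1, this]
    omega
  · have hkj : k ≠ j := fun h => h2 (by rw [h])
    have := hsec (j + 1) N (by omega) (by omega) le_rfl
    rw [hNx, ← hsucc] at this
    rw [← h1, this]
    omega
  · rw [hlast _ h1] at h2 ⊢
    have hkN : k ≠ N - 1 := fun h => h2 (by rw [h])
    rw [hsec j (N - 1) (by omega) (by omega) (by omega)]
    omega
  · rw [hlast _ h1] at h2 h4 ⊢
    have hkN : k ≠ N - 1 := fun h => h2 (by rw [h])
    have hkj : k ≠ j := fun h => h3 (by rw [h])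
    have hjN : N - 1 ≠ j := fun h => h4 (by rw [h])
    rw [hsucc, hsec (j + 1) (N - 1) (by omega) (by omega) (by omega)]
    omega

theorem liesRight_nil {a b d : G.Dart} : M.LiesRight a b [] d ↔ M.InSector a b d := by
  simp [LiesRight]

theorem liesLeft_nil {a b d : G.Dart} : M.LiesLeft a b [] d ↔ M.InSector b a d := by
  simp [LiesLeft]

/-- After `x`, the rest is again a path, entered along `x.symm`, a real edge. Inductions on the path
must therefore allow a real edge in place of the first dummy edge. -/
theorem liesRight_cons {a b x d : G.Dart} {p : List G.Dart} :
    M.LiesRight a b (x :: p) d ↔ M.InSector a x d ∨ M.LiesRight (M.faceNext x.symm) b p d := by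
  simp [LiesRight]

theorem liesLeft_cons {a b x d : G.Dart} {p : List G.Dart} :
    M.LiesLeft a b (x :: p) d ↔ M.InSector (M.faceNext x) a d ∨ M.LiesLeft x.symm b p d := by
  simp [LiesLeft]

variable {M}

theorem LiesRight.tail_mem {a b d : G.Dart} {p : List G.Dart} (h : M.LiesRight a b p d) :
    M.tail d ∈ M.tail a :: p.map M.head := by
  induction p generalizing a with
  | nil => simpa using ((liesRight_nil M).1 h).tail_eq
  | cons x p ih =>
    rcases (liesRight_cons M).1 h with h | h
    · simp [h.tail_eq]
    · have := ih h
      rw [tail_faceNext, tail_symm] at this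
      exact List.mem_cons_of_mem _ this

theorem LiesLeft.tail_mem {f : M.Face} {a b d : G.Dart} {p : List G.Dart}
    (hp : M.IsDualWalk f p (M.tail b)) (h : M.LiesLeft a b p d) :
    M.tail d ∈ f :: p.map M.head := by
  induction p generalizing a f with
  | nil =>
    have hp : f = M.tail b := hp
    simpa [hp] using ((liesLeft_nil M).1 h).tail_eq
  | cons x p ih =>
    rcases (liesLeft_cons M).1 h with h | h
    · rw [h.tail_eq, tail_faceNext, hp.1]
      exact List.mem_cons_self
    · exact List.mem_cons_of_mem _ (ih hp.2 h)

theorem IsDualWalk.tail_mem_and_head_mem {f g : M.Face} {p : List G.Dart}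
    (hp : M.IsDualWalk f p g) {d : G.Dart} (hd : d.edge ∈ p.map SimpleGraph.Dart.edge) :
    M.tail d ∈ f :: p.map M.head ∧ M.head d ∈ f :: p.map M.head := by
  induction p generalizing f with
  | nil => simp at hd
  | cons x p ih =>
    rw [List.map_cons, List.mem_cons, SimpleGraph.dart_edge_eq_iff] at hd
    rcases hd with (rfl | rfl) | hd
    · simp [hp.1]
    · simp [hp.1]
    · have := ih hp.2 hd
      exact ⟨List.mem_cons_of_mem _ this.1, List.mem_cons_of_mem _ this.2⟩

/-- A dart to the right of a path does not lie on the path.  The path may be the end of a longer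
one, in which case it is entered along the reverse of the dart `z`. -/
theorem LiesRight.notMem [Finite G.Dart] {f : M.Face} {a b d z : G.Dart} {p : List G.Dart}
    (hp : M.IsDualPath f p (M.tail b)) (ha : M.tail a = f) (h : M.LiesRight a b p d) :
    d.edge ∉ p.map SimpleGraph.Dart.edge ∧ (a = M.faceNext z → d ≠ z) := by
  induction p generalizing a f z with
  | nil =>
    refine ⟨by simp, ?_⟩
    rintro rfl rfl
    have hp : f = M.tail b := hp.1
    rw [liesRight_nil] at h
    exact M.not_inSector_faceNext (by rw [← hp, ← ha, tail_faceNext]) h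
  | cons x p ih =>
    obtain ⟨⟨hx, hw⟩, hnd⟩ := hp
    rw [List.map_cons, List.nodup_cons] at hnd
    rcases (liesRight_cons M).1 h with h | h
    · have hd := h.tail_eq.trans ha
      constructor
      · rw [List.map_cons, List.mem_cons, SimpleGraph.dart_edge_eq_iff]
        rintro ((rfl | rfl) | h')
        · exact M.not_inSector_right _ _ h
        · exact hnd.1 (by rw [← hd]; simp)
        · exact hnd.1 (hd ▸ (hw.tail_mem_and_head_mem h').1)
      · rintro rfl rfl
        exact M.not_inSector_faceNext (by rw [hx, ← hd]) h
    · have h1 := ih (z := x.symm) ⟨hw, hnd.2⟩ (by rw [tail_faceNext, tail_symm]) h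
      have h2 := h.tail_mem
      rw [tail_faceNext, tail_symm] at h2
      constructor
      · rw [List.map_cons, List.mem_cons, SimpleGraph.dart_edge_eq_iff]
        rintro ((rfl | rfl) | h')
        · exact hnd.1 (hx ▸ h2)
        · exact h1.2 rfl rfl
        · exact h1.1 h'
      · rintro rfl rfl
        rw [tail_faceNext] at ha
        exact hnd.1 (ha ▸ h2)

/-- In the induction `a` becomes the reverse of the entering dart; the clause `d ≠ a` then keeps
that edge off the left side. -/
theorem LiesLeft.notMem [Finite G.Dart] {f : M.Face} {a b d : G.Dart} {p : List G.Dart}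
    (hp : M.IsDualPath f p (M.tail b)) (ha : M.tail a = f) (h : M.LiesLeft a b p d) :
    d.edge ∉ p.map SimpleGraph.Dart.edge ∧ d ≠ a := by
  induction p generalizing a f with
  | nil =>
    refine ⟨by simp, ?_⟩
    rintro rfl
    exact M.not_inSector_right _ _ ((liesLeft_nil M).1 h)
  | cons x p ih =>
    obtain ⟨⟨hx, hw⟩, hnd⟩ := hp
    rw [List.map_cons, List.nodup_cons] at hnd
    rcases (liesLeft_cons M).1 h with h | h
    · have hd : M.tail d = f := by rw [h.tail_eq, tail_faceNext, hx]
      constructor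
      · rw [List.map_cons, List.mem_cons, SimpleGraph.dart_edge_eq_iff]
        rintro ((rfl | rfl) | h')
        · exact M.not_inSector_faceNext (by rw [hx, ha]) h
        · exact hnd.1 (by rw [← hd]; simp)
        · exact hnd.1 (hd ▸ (hw.tail_mem_and_head_mem h').1)
      · rintro rfl
        exact M.not_inSector_right _ _ h
    · have h1 := ih ⟨hw, hnd.2⟩ (by rw [tail_symm]) h
      have h2 := h.tail_mem hw
      constructor
      · rw [List.map_cons, List.mem_cons, SimpleGraph.dart_edge_eq_iff]
        rintro ((rfl | rfl) | h')
        · exact hnd.1 (hx ▸ h2)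
        · exact h1.2 rfl
        · exact h1.1 h'
      · rintro rfl
        exact hnd.1 (ha ▸ h2)

/-- Away from the path, left and right are complementary.  The path is entered along a dummy edge
(`a' = a`) or along the reverse of the dart `a`. -/
theorem liesLeft_iff_not_liesRight_aux [Finite G.Dart] {f : M.Face} {a a' b d : G.Dart}
    {p : List G.Dart} (hp : M.IsDualPath f p (M.tail b)) (ha : M.tail a = f)
    (h : (a' = a ∧ a ≠ b) ∨ (a' = M.faceNext a ∧ d ≠ a ∧ M.head a ∉ f :: p.map M.head))
    (hd : M.tail d ∈ f :: p.map M.head) (hdp : d.edge ∉ p.map SimpleGraph.Dart.edge) :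
    M.LiesLeft a b p d ↔ ¬ M.LiesRight a' b p d := by
  induction p generalizing a a' f with
  | nil =>
    have hp : f = M.tail b := hp.1
    have hd : M.tail d = f := by simpa using hd
    rw [liesLeft_nil, liesRight_nil]
    apply M.inSector_iff_not_inSector (by rw [ha, hd]) (by rw [hd, hp])
    rcases h with h | h
    · exact Or.inl ⟨h.1, rfl, h.2⟩
    · exact Or.inr (Or.inr (Or.inl ⟨h.1, h.2.1, rfl⟩))
  | cons x p ih =>
    obtain ⟨⟨hx, hw⟩, hnd⟩ := hp
    rw [List.map_cons, List.nodup_cons] at hnd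
    rw [List.map_cons, List.mem_cons, SimpleGraph.dart_edge_eq_iff, not_or, not_or] at hdp
    have ha' : M.tail a' = f := by
      rcases h with h | h <;> rw [h.1, ← ha]
      rw [tail_faceNext]
    rw [liesLeft_cons, liesRight_cons]
    rw [List.map_cons, List.mem_cons] at hd
    rcases hd with hd | hd
    · have h1 : ¬ M.LiesLeft x.symm b p d := fun h => hnd.1 (hd ▸ h.tail_mem hw)
      have h2 : ¬ M.LiesRight (M.faceNext x.symm) b p d := fun h => by
        have := h.tail_mem
        rw [tail_faceNext, tail_symm, hd] at this
        exact hnd.1 this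
      have h3 : M.InSector (M.faceNext x) a d ↔ ¬ M.InSector a' x d := by
        apply M.inSector_iff_not_inSector (by rw [ha, hd]) (by rw [hd, hx])
        rcases h with h | h
        · exact Or.inr (Or.inl ⟨h.1, rfl, hdp.1.1⟩)
        · refine Or.inr (Or.inr (Or.inr ⟨h.1, h.2.1, rfl, hdp.1.1, ?_⟩))
          rintro rfl
          simp at h
      tauto
    · have h1 : ¬ M.InSector (M.faceNext x) a d := fun h => by
        rw [h.tail_eq, tail_faceNext, hx] at hd
        exact hnd.1 hd
      have h2 : ¬ M.InSector a' x d := fun h => by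
        rw [h.tail_eq, ha'] at hd
        exact hnd.1 hd
      have h3 := ih (a := x.symm) (a' := M.faceNext x.symm) ⟨hw, hnd.2⟩ (by simp)
        (Or.inr ⟨rfl, hdp.1.2, by rw [head_symm, hx]; exact hnd.1⟩) hd hdp.2
      tauto

/-! ### The walk in `G` along the right side of a path -/

section Sum

open scoped Classical

variable [Fintype G.Dart]

variable (M) in
-- The sum telescopes, since consecutive darts around a face share a vertex.
theorem sum_inSector (φ : V → ZMod 2) {x y : G.Dart} (h : M.tail y = M.tail x) :
    ∑ d with M.InSector x y d, (φ d.fst + φ d.snd) = φ x.fst + φ y.fst := by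
  obtain ⟨N, hN0, hNx, hN, hex⟩ := M.exists_faceNext_period x
  obtain ⟨j, hj, rfl⟩ := hex y h
  have hsec : (Finset.univ.filter fun d => M.InSector x ((M.faceNext ^ j) x) d) =
      (Finset.range j).image fun k => (M.faceNext ^ k) x := by
    ext d
    have := M.inSector_pow_iff hN (Nat.zero_le j) (by omega) (d := d)
    rw [pow_zero, Equiv.Perm.one_apply] at this
    simp [this]
  rw [hsec, Finset.sum_image]
  · clear hj h hsec
    induction j with
    | zero => simpa using (CharTwo.add_self_eq_zero _).symm
    | succ j ih =>
      rw [Finset.sum_range_succ, ih, pow_succ', Equiv.Perm.mul_apply, fst_faceNext]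
      have := CharTwo.add_self_eq_zero (φ ((M.faceNext ^ j) x).fst)
      linear_combination this
  · intro i hi k hk hik
    simp only [Finset.coe_range, Set.mem_Iio] at hi hk
    rcases lt_trichotomy i k with h1 | h1 | h1
    · exact absurd hik (hN _ _ h1 (by omega))
    · exact h1
    · exact absurd hik.symm (hN _ _ h1 (by omega))

/-- The darts to the right of a dual path form a walk in `G` that joins its two corners. -/
theorem sum_liesRight (φ : V → ZMod 2) {f : M.Face} {a b : G.Dart} {p : List G.Dart}
    (hp : M.IsDualPath f p (M.tail b)) (ha : M.tail a = f) :
    ∑ d with M.LiesRight a b p d, (φ d.fst + φ d.snd) = φ a.fst + φ b.fst := by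
  induction p generalizing a f with
  | nil =>
    simp only [liesRight_nil]
    exact M.sum_inSector φ (by rw [ha]; exact hp.1.symm)
  | cons x p ih =>
    obtain ⟨⟨hx, hw⟩, hnd⟩ := hp
    rw [List.map_cons, List.nodup_cons] at hnd
    simp only [liesRight_cons]
    rw [Finset.filter_or, Finset.sum_union, M.sum_inSector φ (by rw [hx, ha]),
      ih ⟨hw, hnd.2⟩ (by rw [tail_faceNext, tail_symm]), fst_faceNext]
    -- The two walks meet at `x.fst`: the sector before `x` ends there, and `faceNext x.symm` starts
    -- there.
    · have := CharTwo.add_self_eq_zero (φ x.fst)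
      simp only [SimpleGraph.Dart.symm_toProd, Prod.snd_swap]
      linear_combination this
    · rw [Finset.disjoint_filter]
      intro d _ h1 h2
      have := h2.tail_mem
      rw [tail_faceNext, tail_symm, h1.tail_eq, ha] at this
      exact hnd.1 this

end Sum

end PlaneEmbedding

namespace PlaneEmbedding

variable {V : Type*} {G : SimpleGraph V} {M : PlaneEmbedding G}

/-! ### Dual walks -/

theorem isDualWalk_append {f g : M.Face} {p q : List G.Dart} :
    M.IsDualWalk f (p ++ q) g ↔ ∃ h, M.IsDualWalk f p h ∧ M.IsDualWalk h q g := by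
  induction p generalizing f with
  | nil => simp [IsDualWalk]
  | cons x p ih => simp [IsDualWalk, ih, and_assoc]

theorem IsDualWalk.append {f g h : M.Face} {p q : List G.Dart} (hp : M.IsDualWalk f p g)
    (hq : M.IsDualWalk g q h) : M.IsDualWalk f (p ++ q) h :=
  isDualWalk_append.2 ⟨g, hp, hq⟩

theorem IsDualWalk.reverse {f g : M.Face} {p : List G.Dart} (hp : M.IsDualWalk f p g) :
    M.IsDualWalk g (p.reverse.map SimpleGraph.Dart.symm) f := by
  induction p generalizing f with
  | nil => exact Eq.symm hp
  | cons x p ih =>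
    rw [List.reverse_cons, List.map_append]
    exact (ih hp.2).append ⟨rfl, by rw [head_symm]; exact hp.1⟩

theorem IsDualWalk.map_tail_append {f g : M.Face} {p : List G.Dart} (hp : M.IsDualWalk f p g) :
    p.map M.tail ++ [g] = f :: p.map M.head := by
  induction p generalizing f with
  | nil => simpa using Eq.symm hp
  | cons x p ih => simp [ih hp.2, hp.1]

theorem IsDualWalk.nodup_map_head {f : M.Face} {p : List G.Dart} (hp : M.IsDualWalk f p f)
    (h : (p.map M.tail).Nodup) : (p.map M.head).Nodup := by
  refine (List.Perm.nodup_iff ?_).1 h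
  rw [← List.perm_cons f, ← hp.map_tail_append]
  exact (List.perm_append_singleton _ _).symm

/-- The ends of a nonempty walk are determined by its darts. -/
theorem IsDualWalk.ends_unique {f g f' g' : M.Face} {p : List G.Dart} (hp : M.IsDualWalk f p g)
    (hp' : M.IsDualWalk f' p g') (hne : p ≠ []) : f = f' ∧ g = g' := by
  have h := hp.map_tail_append
  have h' := hp'.map_tail_append
  cases p with
  | nil => exact absurd rfl hne
  | cons x p =>
    have hf : f = f' := hp.1.symm.trans hp'.1
    subst hf
    rw [← h'] at h
    exact ⟨rfl, by simpa using h⟩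

/-- The suffix clause passes simplicity on to the second part. -/
theorem IsDualWalk.exists_split {f g h : M.Face} {p : List G.Dart} (hp : M.IsDualWalk f p g)
    (hh : h ∈ f :: p.map M.head) : ∃ q r, p = q ++ r ∧ M.IsDualWalk f q h ∧ M.IsDualWalk h r g ∧
      (h :: r.map M.head) <:+ (f :: p.map M.head) := by
  induction p generalizing f with
  | nil =>
    obtain rfl : h = f := by simpa using hh
    exact ⟨[], [], rfl, rfl, hp, List.suffix_rfl⟩
  | cons x p ih =>
    rcases List.mem_cons.1 hh with rfl | hh
    · exact ⟨[], x :: p, rfl, rfl, hp, List.suffix_rfl⟩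
    · obtain ⟨q, r, rfl, hq, hr, hs⟩ := ih hp.2 hh
      exact ⟨x :: q, r, rfl, ⟨hp.1, hq⟩, hr, hs.trans (List.suffix_cons _ _)⟩

theorem length_cons (c : Sym2 V → ℝ) (x : G.Dart) (p : List G.Dart) :
    M.length c (x :: p) = c x.edge + M.length c p := by
  simp [length]

theorem length_append (c : Sym2 V → ℝ) (p q : List G.Dart) :
    M.length c (p ++ q) = M.length c p + M.length c q := by
  simp [length]

theorem length_reverse (c : Sym2 V → ℝ) (p : List G.Dart) :
    M.length c (p.reverse.map SimpleGraph.Dart.symm) = M.length c p := by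
  induction p with
  | nil => rfl
  | cons x p ih =>
    rw [List.reverse_cons, List.map_append, length_append, ih, length_cons]
    simp [length, add_comm]

theorem length_nonneg {c : Sym2 V → ℝ} (hc : ∀ e ∈ G.edgeSet, 0 < c e) (p : List G.Dart) :
    0 ≤ M.length c p := by
  induction p with
  | nil => exact le_rfl
  | cons x p ih =>
    rw [length_cons]
    exact add_nonneg (hc _ x.edge_mem).le ih

theorem length_pos {c : Sym2 V → ℝ} (hc : ∀ e ∈ G.edgeSet, 0 < c e) {p : List G.Dart}
    (hp : p ≠ []) : 0 < M.length c p := by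
  cases p with
  | nil => exact absurd rfl hp
  | cons x p =>
    rw [length_cons]
    exact add_pos_of_pos_of_nonneg (hc _ x.edge_mem) (length_nonneg hc p)

/-- Loop erasure, which removes only darts of positive length. -/
theorem IsDualWalk.exists_path {c : Sym2 V → ℝ} (hc : ∀ e ∈ G.edgeSet, 0 < c e) {f g : M.Face}
    {p : List G.Dart} (hp : M.IsDualWalk f p g) :
    ∃ q, M.IsDualPath f q g ∧ M.length c q ≤ M.length c p := by
  induction p generalizing f with
  | nil => exact ⟨[], ⟨hp, by simp⟩, le_rfl⟩
  | cons x p ih =>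
    obtain ⟨q, hq, hle⟩ := ih hp.2
    rw [length_cons]
    by_cases hf : f ∈ M.head x :: q.map M.head
    · obtain ⟨r, q', rfl, -, hq', hs⟩ := hq.1.exists_split hf
      refine ⟨q', ⟨hq', hs.sublist.nodup hq.2⟩, ?_⟩
      rw [length_append] at hle
      have := length_nonneg (M := M) hc r
      have := hc _ x.edge_mem
      linarith
    · refine ⟨x :: q, ⟨⟨hp.1, hq.1⟩, List.nodup_cons.2 ⟨hf, hq.2⟩⟩, ?_⟩
      rw [length_cons]
      linarith

/-- The stretch of a shortest path between two of its vertices is shortest among all walks. -/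
theorem IsShortestDualPath.exists_stretch {c : Sym2 V → ℝ} (hc : ∀ e ∈ G.edgeSet, 0 < c e)
    {f g u v : M.Face} {p : List G.Dart} (hp : M.IsShortestDualPath c f p g)
    (hu : u ∈ f :: p.map M.head) (hv : v ∈ f :: p.map M.head) :
    ∃ q, M.IsDualWalk u q v ∧ (∀ d ∈ q, d.edge ∈ p.map SimpleGraph.Dart.edge) ∧
      ∀ r, M.IsDualWalk u r v → M.length c q ≤ M.length c r := by
  have hmin : ∀ w, M.IsDualWalk f w g → M.length c p ≤ M.length c w := by
    intro w hw
    obtain ⟨q, hq, hle⟩ := hw.exists_path hc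
    exact (hp.2 q hq).trans hle
  obtain ⟨p₁, p₂, rfl, h₁, h₂, -⟩ := hp.1.1.exists_split hu
  rw [List.map_append, ← List.cons_append, List.mem_append] at hv
  -- If `v` precedes `u` on the path, the stretch is traversed backwards. In either order, a shorter
  -- walk could be spliced into `p`.
  rcases hv with hv | hv
  · obtain ⟨q₁, q₂, rfl, hq₁, hq₂, -⟩ := h₁.exists_split hv
    refine ⟨_, hq₂.reverse, ?_, ?_⟩
    · intro d hd
      simp only [List.mem_map, List.mem_reverse] at hd
      obtain ⟨d, hd, rfl⟩ := hd
      rw [SimpleGraph.Dart.edge_symm]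
      exact List.mem_map_of_mem (by simp [hd])
    · intro r hr
      have := hmin _ ((hq₁.append hr.reverse).append h₂)
      simp only [length_append, length_reverse] at this ⊢
      linarith
  · obtain ⟨q₁, q₂, rfl, hq₁, hq₂, -⟩ := h₂.exists_split (List.mem_cons_of_mem _ hv)
    refine ⟨_, hq₁, ?_, ?_⟩
    · intro d hd
      exact List.mem_map_of_mem (by simp [hd])
    · intro r hr
      have := hmin _ ((h₁.append hr).append hq₂)
      simp only [length_append] at this ⊢
      linarith

/-! ### The parity of a dual walk -/

section Parity

open scoped Classical

/-- The indicator of the darts to the right of a path. -/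
noncomputable def rightIndicator (M : PlaneEmbedding G) (a b : G.Dart) (p : List G.Dart)
    (d : G.Dart) : ZMod 2 :=
  if M.LiesRight a b p d then 1 else 0

/-- The number, mod 2, of dart ends of the walk `W` to the right of the path `p`; this is how often,
mod 2, the walk crosses the walk in `G` along the right side of the path. -/
noncomputable def parity (M : PlaneEmbedding G) (a b : G.Dart) (p W : List G.Dart) : ZMod 2 :=
  (W.map fun x => M.rightIndicator a b p x + M.rightIndicator a b p x.symm).sum

theorem parity_append (a b : G.Dart) (p W W' : List G.Dart) :
    M.parity a b p (W ++ W') = M.parity a b p W + M.parity a b p W' := by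
  simp [parity]

theorem parity_eq_zero {a b : G.Dart} {p W : List G.Dart}
    (h : ∀ x ∈ W, ¬ M.LiesRight a b p x ∧ ¬ M.LiesRight a b p x.symm) :
    M.parity a b p W = 0 := by
  apply List.sum_eq_zero
  intro z hz
  obtain ⟨x, hx, rfl⟩ := List.mem_map.1 hz
  simp [rightIndicator, h x hx]

theorem ne_nil_of_parity {a b : G.Dart} {p W : List G.Dart} (h : M.parity a b p W = 1) :
    W ≠ [] := by
  rintro rfl
  simp [parity] at h

/-- The edges that a list of dual darts crosses an odd number of times. -/
noncomputable def edgeChain (W : List G.Dart) : G.edgeSet → ZMod 2 :=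
  (W.map fun x => (Pi.single (toEdge x) 1 : G.edgeSet → ZMod 2)).sum

theorem edgeChain_cons (x : G.Dart) (W : List G.Dart) :
    edgeChain (x :: W) = Pi.single (toEdge x) 1 + edgeChain W := by
  simp [edgeChain]

theorem edgeChain_eq_zero {W : List G.Dart} {d : G.Dart}
    (h : d.edge ∉ W.map SimpleGraph.Dart.edge) : edgeChain W (toEdge d) = 0 := by
  induction W with
  | nil => simp [edgeChain]
  | cons x W ih =>
    rw [List.map_cons, List.mem_cons, not_or] at h
    rw [edgeChain_cons, Pi.add_apply, ih h.2, add_zero, Pi.single_eq_of_ne]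
    intro he
    exact h.1 (congrArg Subtype.val he)

theorem edgeChain_eq_one {W : List G.Dart} {d : G.Dart}
    (hnd : (W.map SimpleGraph.Dart.edge).Nodup) (h : d.edge ∈ W.map SimpleGraph.Dart.edge) :
    edgeChain W (toEdge d) = 1 := by
  induction W with
  | nil => simp at h
  | cons x W ih =>
    rw [List.map_cons, List.nodup_cons] at hnd
    rw [edgeChain_cons, Pi.add_apply]
    by_cases hx : d.edge = x.edge
    · rw [edgeChain_eq_zero (hx ▸ hnd.1), add_zero]
      have : toEdge d = toEdge x := Subtype.ext hx
      rw [this, Pi.single_eq_same]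
    · rw [ih hnd.2 ((List.mem_cons.1 h).resolve_left hx), Pi.single_eq_of_ne, zero_add]
      intro he
      exact hx (congrArg Subtype.val he)

variable [Fintype G.Dart]

theorem boundary_edgeChain {f g : M.Face} {W : List G.Dart} (hW : M.IsDualWalk f W g) :
    M.boundary (edgeChain W) = Pi.single f 1 + Pi.single g 1 := by
  induction W generalizing f with
  | nil =>
    obtain rfl : f = g := hW
    rw [show edgeChain ([] : List G.Dart) = 0 from rfl, map_zero]
    funext g
    exact (CharTwo.add_self_eq_zero _).symm
  | cons x W ih =>
    rw [edgeChain_cons, map_add, ih hW.2, boundary_single, hW.1]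
    funext h
    have := CharTwo.add_self_eq_zero ((Pi.single (M.head x) 1 : M.Face → ZMod 2) h)
    simp only [Pi.add_apply]
    linear_combination this

/-- This links the combinatorial parity to homology: it is the pairing of the chain of `W` with the
walk along the right side of `p`. -/
theorem sum_liesRight_edgeChain (a b : G.Dart) (p W : List G.Dart) :
    ∑ d with M.LiesRight a b p d, edgeChain W (toEdge d) = M.parity a b p W := by
  induction W with
  | nil => simp [edgeChain, parity]
  | cons x W ih =>
    simp only [edgeChain_cons, Pi.add_apply, Finset.sum_add_distrib, ih, sum_toEdge_eq]
    simp [parity, rightIndicator]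

/-- A closed dual walk of odd parity separates. -/
theorem not_reachable_of_parity [Finite V] (hG : G.Connected) {a b : G.Dart} {p : List G.Dart}
    (hp : M.IsDualPath (M.tail a) p (M.tail b)) {f : M.Face} {W : List G.Dart}
    (hW : M.IsDualWalk f W f) (hpar : M.parity a b p W = 1) :
    ¬ (G.deleteEdges {e | e ∈ W.map SimpleGraph.Dart.edge}).Reachable a.fst b.fst := by
  have hbd : M.boundary (edgeChain W) = 0 := by
    rw [boundary_edgeChain hW]
    funext g
    exact CharTwo.add_self_eq_zero _
  obtain ⟨φ, hφ⟩ := M.exists_coboundary_eq hG a hbd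
  -- The potential `φ` differs at the two corners, but it changes only across edges of `W`.
  have h1 : φ a.fst + φ b.fst = 1 := by
    rw [← sum_liesRight φ hp rfl, ← hpar, ← sum_liesRight_edgeChain, ← hφ]
    rfl
  rintro ⟨w⟩
  have hw : ∀ u v, (G.deleteEdges {e | e ∈ W.map SimpleGraph.Dart.edge}).Walk u v → φ u = φ v := by
    intro u v w
    induction w with
    | nil => rfl
    | @cons u v _ h w ih =>
      rw [← ih]
      rw [SimpleGraph.deleteEdges_adj] at h
      have h2 := edgeChain_eq_zero (W := W) (d := ⟨(u, v), h.1⟩) h.2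
      rw [← hφ, coboundary_toEdge] at h2
      exact CharTwo.add_eq_zero.1 h2
  rw [hw _ _ w, CharTwo.add_self_eq_zero] at h1
  exact zero_ne_one h1

/-- A cut contained in a dual cycle takes the same value at consecutive edges of the cycle. -/
theorem eq_of_boundary_eq_zero {X : G.edgeSet → ZMod 2} (hX : M.boundary X = 0) {C : List G.Dart}
    (hC : M.IsDualCycle C)
    (hsupp : ∀ d : G.Dart, d.edge ∉ C.map SimpleGraph.Dart.edge → X (toEdge d) = 0)
    {x y : G.Dart} (hx : x ∈ C) (hy : y ∈ C) (hxy : M.head x = M.tail y) :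
    X (toEdge x) = X (toEdge y) := by
  obtain ⟨-, ⟨f, hf⟩, htail, hedge⟩ := hC
  have hhead := hf.nodup_map_head htail
  have hne : y ≠ x.symm := by
    rintro rfl
    have := List.inj_on_of_nodup_map hedge hx hy (by simp)
    exact x.symm_ne this.symm
  have h := congrFun hX (M.tail y)
  -- The cycle visits this face once, so `y` and `x.symm` are its only dart ends there; a zero
  -- boundary forces equal values on them.
  rw [boundary_apply, ← Finset.sum_subset (s₁ := {y, x.symm}), Finset.sum_pair hne, toEdge_symm]
    at h
  · exact (CharTwo.add_eq_zero.1 h).symm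
  · intro d
    simp only [Finset.mem_insert, Finset.mem_singleton, Finset.mem_filter, Finset.mem_univ,
      true_and]
    rintro (rfl | rfl)
    · rfl
    · exact hxy
  · intro d hd hd'
    simp only [Finset.mem_insert, Finset.mem_singleton, Finset.mem_filter, Finset.mem_univ,
      true_and, not_or] at hd hd'
    apply hsupp
    intro hmem
    obtain ⟨z, hz, hzd⟩ := List.mem_map.1 hmem
    rcases SimpleGraph.dart_edge_eq_iff _ _ |>.1 hzd with rfl | rfl
    · exact hd'.1 (List.inj_on_of_nodup_map htail hz hy hd)
    · have := List.inj_on_of_nodup_map hhead hz hx (by rw [head_symm, hd, hxy])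
      exact hd'.2 (by rw [← this, SimpleGraph.Dart.symm_symm])

/-- Separating cycles have odd parity. -/
theorem IsSeparatingCycle.parity_eq_one (hG : G.Connected) {a b : G.Dart}
    {p : List G.Dart} (hp : M.IsDualPath (M.tail a) p (M.tail b)) {C : List G.Dart}
    (hC : M.IsSeparatingCycle a.fst b.fst C) : M.parity a b p C = 1 := by
  obtain ⟨hcyc, hsep⟩ := hC
  set H := G.deleteEdges {e | e ∈ C.map SimpleGraph.Dart.edge} with hH
  -- The component of `s` after the deletion: its cut is contained in `C`, and will turn out to be
  -- all of `C`.
  set φ : V → ZMod 2 := fun v => if H.Reachable a.fst v then 1 else 0 with hφ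
  have hsupp : ∀ d : G.Dart, d.edge ∉ C.map SimpleGraph.Dart.edge →
      coboundary G φ (toEdge d) = 0 := by
    intro d hd
    have hadj : H.Adj d.fst d.snd := by
      rw [hH, SimpleGraph.deleteEdges_adj]
      exact ⟨d.adj, hd⟩
    have : φ d.fst = φ d.snd := by
      have h2 : H.Reachable a.fst d.fst ↔ H.Reachable a.fst d.snd :=
        ⟨fun h => h.trans hadj.reachable, fun h => h.trans hadj.symm.reachable⟩
      simp only [hφ, h2]
    rw [coboundary_toEdge, this, CharTwo.add_self_eq_zero]
  have hconst : ∀ (W : List G.Dart) (f g : M.Face), M.IsDualWalk f W g → (∀ x ∈ W, x ∈ C) →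
      ∃ k, ∀ x ∈ W, coboundary G φ (toEdge x) = k := by
    intro W
    induction W with
    | nil => exact fun _ _ _ _ => ⟨0, by simp⟩
    | cons x W ih =>
      intro f g hW hsub
      obtain ⟨k, hk⟩ := ih _ _ hW.2 fun y hy => hsub y (List.mem_cons_of_mem _ hy)
      cases W with
      | nil => exact ⟨coboundary G φ (toEdge x), by simp⟩
      | cons y W =>
        refine ⟨k, ?_⟩
        intro z hz
        rcases List.mem_cons.1 hz with rfl | hz
        · rw [eq_of_boundary_eq_zero (M.boundary_coboundary φ) hcyc hsupp (hsub z (by simp))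
            (hsub y (by simp)) hW.2.1.symm]
          exact hk y (by simp)
        · exact hk z hz
  obtain ⟨f, hf⟩ := hcyc.2.1
  obtain ⟨k, hk⟩ := hconst C f f hf fun _ h => h
  have hk' : ∀ d : G.Dart, d.edge ∈ C.map SimpleGraph.Dart.edge →
      coboundary G φ (toEdge d) = k := by
    intro d hd
    obtain ⟨x, hx, hxd⟩ := List.mem_map.1 hd
    rw [show toEdge d = toEdge x from Subtype.ext hxd.symm, hk x hx]
  have ha : φ a.fst = 1 := if_pos (SimpleGraph.Reachable.refl _)
  have hb : φ b.fst = 0 := if_neg hsep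
  -- With value `0` the cut would be empty and `φ` constant on the connected graph `G`, although it
  -- separates `s` from `t`.
  have hk1 : k = 1 := by
    have h01 : ∀ k : ZMod 2, k ≠ 0 → k = 1 := by decide
    apply h01
    rintro rfl
    have hadj : ∀ u v, G.Adj u v → φ u = φ v := by
      intro u v h
      have h2 : coboundary G φ (toEdge ⟨(u, v), h⟩) = 0 := by
        by_cases hmem : (⟨(u, v), h⟩ : G.Dart).edge ∈ C.map SimpleGraph.Dart.edge
        · exact hk' _ hmem
        · exact hsupp _ hmem
      exact CharTwo.add_eq_zero.1 h2
    have hw : ∀ u v, G.Walk u v → φ u = φ v := by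
      intro u v w
      induction w with
      | nil => rfl
      | cons h w ih => exact (hadj _ _ h).trans ih
    obtain ⟨w⟩ := hG.preconnected a.fst b.fst
    have := hw _ _ w
    rw [ha, hb] at this
    exact one_ne_zero this
  have hX : ∀ d : G.Dart, edgeChain C (toEdge d) = φ d.fst + φ d.snd := by
    intro d
    rw [← coboundary_toEdge]
    by_cases hmem : d.edge ∈ C.map SimpleGraph.Dart.edge
    · rw [hk' d hmem, edgeChain_eq_one hcyc.2.2.2 hmem, hk1]
    · rw [hsupp d hmem, edgeChain_eq_zero hmem]
  rw [← sum_liesRight_edgeChain]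
  simp only [hX]
  rw [sum_liesRight φ hp rfl, ha, hb, add_zero]

end Parity

/-! ### Odd closed walks contain separating cycles -/

theorem exists_eq_append_of_not_nodup_map {α β : Type*} (g : α → β) {l : List α}
    (h : ¬ (l.map g).Nodup) :
    ∃ l₁ x l₂ y l₃, l = l₁ ++ (x :: l₂) ++ (y :: l₃) ∧ g x = g y := by
  induction l with
  | nil => simp at h
  | cons z l ih =>
    rw [List.map_cons, List.nodup_cons, not_and_or, not_not] at h
    rcases h with h | h
    · obtain ⟨y, hy, hzy⟩ := List.mem_map.1 h
      obtain ⟨l₂, l₃, rfl⟩ := List.append_of_mem hy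
      exact ⟨[], z, l₂, y, l₃, rfl, hzy.symm⟩
    · obtain ⟨l₁, x, l₂, y, l₃, rfl, hxy⟩ := ih h
      exact ⟨z :: l₁, x, l₂, y, l₃, rfl, hxy⟩

/-- A repeated vertex splits the walk into two nonempty closed walks, one of them odd, and both
strictly shorter because lengths are positive. -/
theorem exists_separatingCycle_of_parity [Finite V] [Fintype G.Dart] (hG : G.Connected)
    {c : Sym2 V → ℝ} (hc : ∀ e ∈ G.edgeSet, 0 < c e) {a b : G.Dart} {p : List G.Dart}
    (hp : M.IsDualPath (M.tail a) p (M.tail b)) {f : M.Face} {W : List G.Dart}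
    (hW : M.IsDualWalk f W f) (hpar : M.parity a b p W = 1) :
    M.IsSeparatingCycle a.fst b.fst W ∨
      ∃ C, M.IsSeparatingCycle a.fst b.fst C ∧ M.length c C < M.length c W := by
  induction hn : W.length using Nat.strong_induction_on generalizing W f with
  | _ n ih =>
  subst hn
  by_cases htail : (W.map M.tail).Nodup
  · left
    refine ⟨⟨ne_nil_of_parity hpar, ⟨f, hW⟩, htail, ?_⟩, not_reachable_of_parity hG hp hW hpar⟩
    -- With distinct vertices, an edge can repeat only in a walk that goes along a dart and straight
    -- back. Any further dart would repeat a vertex, and the parity of such a walk is zero.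
    by_contra hedge
    obtain ⟨α, x, β, y, γ, rfl, hxy⟩ := exists_eq_append_of_not_nodup_map _ hedge
    rcases SimpleGraph.dart_edge_eq_iff _ _ |>.1 hxy with rfl | rfl
    · simp [List.nodup_append] at htail
    · obtain ⟨v, hv, hy⟩ := isDualWalk_append.1 hW
      obtain ⟨u, hu, hx⟩ := isDualWalk_append.1 hv
      have hyv : M.tail y = v := hy.1
      have hux : M.head y = u := hx.1
      have hβ : β = [] := by
        cases β with
        | nil => rfl
        | cons z β =>
          have : M.tail z = M.tail y := by simpa using hx.2.1
          simp [List.nodup_append, this] at htail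
      subst hβ
      have hγ : γ = [] := by
        cases γ with
        | nil => rfl
        | cons z γ =>
          have : M.tail z = M.head y := hy.2.1
          simp [List.nodup_append, this] at htail
      subst hγ
      have hf : M.head y = f := hy.2
      have hα : α = [] := by
        cases α with
        | nil => rfl
        | cons z α =>
          have : M.tail z = M.head y := hu.1.trans hf.symm
          simp [List.nodup_append, this] at htail
      subst hα
      have h0 : M.parity a b p ([] ++ [y.symm] ++ [y]) = 0 := by
        simp only [parity, List.nil_append, List.cons_append, List.map_cons, List.map_nil,
          List.sum_cons, List.sum_nil, SimpleGraph.Dart.symm_symm, add_zero]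
        rw [add_comm (M.rightIndicator a b p y.symm)]
        exact CharTwo.add_self_eq_zero _
      rw [h0] at hpar
      exact zero_ne_one hpar
  · right
    obtain ⟨α, x, β, y, γ, rfl, hxy⟩ := exists_eq_append_of_not_nodup_map _ htail
    obtain ⟨v, hv, hy⟩ := isDualWalk_append.1 hW
    obtain ⟨u, hu, hx⟩ := isDualWalk_append.1 hv
    obtain rfl : u = v := by rw [← hx.1, ← hy.1, hxy]
    have hpos₁ := length_pos (M := M) hc (p := x :: β) (by simp)
    have hpos₂ := length_pos (M := M) hc (p := y :: γ) (by simp)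
    have hnn := length_nonneg (M := M) hc α
    have hsplit : M.parity a b p (x :: β) = 1 ∨ M.parity a b p (α ++ (y :: γ)) = 1 := by
      rw [parity_append, parity_append] at hpar
      rw [parity_append]
      generalize M.parity a b p α = k₁ at *
      generalize M.parity a b p (x :: β) = k₂ at *
      generalize M.parity a b p (y :: γ) = k₃ at *
      revert k₁ k₂ k₃
      decide
    simp only [length_append]
    rcases hsplit with h | h
    · rcases ih _ (by simp only [List.length_append, List.length_cons]; omega) hx h rfl with h' | ⟨C, hC, hlt⟩
      · exact ⟨_, h', by linarith⟩
      · exact ⟨C, hC, by linarith⟩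
    · rcases ih _ (by simp only [List.length_append, List.length_cons]; omega) (hu.append hy) h rfl with h' | ⟨C, hC, hlt⟩
      · exact ⟨_, h', by rw [length_append]; linarith⟩
      · rw [length_append] at hlt
        exact ⟨C, hC, by linarith⟩

/-- An odd closed walk that is no longer than a minimum separating cycle is one itself. -/
theorem IsMinSeparatingCycle.of_parity [Finite V] [Fintype G.Dart] (hG : G.Connected)
    {c : Sym2 V → ℝ} (hc : ∀ e ∈ G.edgeSet, 0 < c e) {a b : G.Dart} {p : List G.Dart}
    (hp : M.IsDualPath (M.tail a) p (M.tail b)) {C : List G.Dart}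
    (hC : M.IsMinSeparatingCycle c a.fst b.fst C) {f : M.Face} {W : List G.Dart}
    (hW : M.IsDualWalk f W f) (hpar : M.parity a b p W = 1)
    (hle : M.length c W ≤ M.length c C) : M.IsMinSeparatingCycle c a.fst b.fst W := by
  rcases exists_separatingCycle_of_parity hG hc hp hW hpar with h | ⟨C', hC', hlt⟩
  · exact ⟨h, fun C' hC' => hle.trans (hC.2 C' hC')⟩
  · have := hC.2 C' hC'
    linarith

end PlaneEmbedding

namespace PlaneEmbedding

variable {V : Type*} {G : SimpleGraph V} {M : PlaneEmbedding G}

/-! ### Segments of a walk between visits to a path -/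

/-- A nonempty dual walk that has its ends, and no other vertices, in `F`. -/
def IsSegment (M : PlaneEmbedding G) (F : List M.Face) (S : List G.Dart) : Prop :=
  S ≠ [] ∧ (∃ u ∈ F, ∃ v ∈ F, M.IsDualWalk u S v) ∧ ∀ x ∈ S.dropLast, M.head x ∉ F

theorem IsDualWalk.exists_segments {F : List M.Face} {f g : M.Face} {W : List G.Dart}
    (hW : M.IsDualWalk f W g) (hf : f ∈ F) (hg : g ∈ F) :
    ∃ L : List (List G.Dart), W = L.flatten ∧ ∀ S ∈ L, M.IsSegment F S := by
  -- Strengthened for the induction: `T` is the part up to the first vertex in `F`, nonempty only if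
  -- the walk starts outside `F`.
  suffices h : ∃ (T : List G.Dart) (L : List (List G.Dart)), W = T ++ L.flatten ∧
      (∀ S ∈ L, M.IsSegment F S) ∧ (f ∈ F → T = []) ∧
      ∃ v ∈ F, M.IsDualWalk f T v ∧ ∀ x ∈ T.dropLast, M.head x ∉ F by
    obtain ⟨T, L, rfl, hL, hT, -⟩ := h
    exact ⟨L, by rw [hT hf, List.nil_append], hL⟩
  clear hf
  induction W generalizing f with
  | nil =>
    obtain rfl : f = g := hW
    exact ⟨[], [], rfl, by simp, fun _ => rfl, f, hg, rfl, by simp⟩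
  | cons d W ih =>
    obtain ⟨T, L, rfl, hL, hT, v, hv, hTv, hint⟩ := ih hW.2
    have hS : M.IsDualWalk f (d :: T) v := ⟨hW.1, hTv⟩
    have hSint : ∀ x ∈ (d :: T).dropLast, M.head x ∉ F := by
      by_cases hd : M.head d ∈ F
      · simp [hT hd]
      · have hne : T ≠ [] := by
          rintro rfl
          exact hd ((show M.head d = v from hTv) ▸ hv)
        rw [List.dropLast_cons_of_ne_nil hne]
        intro x hx
        rcases List.mem_cons.1 hx with rfl | hx
        · exact hd
        · exact hint x hx
    by_cases hf : f ∈ F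
    · refine ⟨[], (d :: T) :: L, rfl, ?_, fun _ => rfl, f, hf, rfl, by simp⟩
      intro S hS'
      rcases List.mem_cons.1 hS' with rfl | hS'
      · exact ⟨by simp, ⟨f, hf, v, hv, hS⟩, hSint⟩
      · exact hL S hS'
    · exact ⟨d :: T, L, rfl, hL, fun h => absurd h hf, v, hv, hS, hSint⟩

theorem IsSegment.tail_notMem {F : List M.Face} {x : G.Dart} {S : List G.Dart}
    (hS : M.IsSegment F (x :: S)) {y : G.Dart} (hy : y ∈ S) : M.tail y ∉ F := by
  obtain ⟨-, ⟨u, -, v, -, hw⟩, hint⟩ := hS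
  have h := congrArg List.dropLast hw.2.map_tail_append
  rw [List.dropLast_concat, ← List.map_cons, ← List.map_dropLast] at h
  have hy' : M.tail y ∈ (x :: S).dropLast.map M.head := by
    rw [← h]
    exact List.mem_map_of_mem hy
  obtain ⟨z, hz, hzy⟩ := List.mem_map.1 hy'
  rw [← hzy]
  exact hint z hz

/-- A segment that starts with `x`, ends with `y`, and has no edge on the path `p`. -/
def IsArc (M : PlaneEmbedding G) (a : G.Dart) (p A : List G.Dart) (x y : G.Dart) : Prop :=
  M.IsSegment (M.tail a :: p.map M.head) A ∧ (∃ A', A = x :: A') ∧ (∃ A', A = A' ++ [y]) ∧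
    ∀ d ∈ A, d.edge ∉ p.map SimpleGraph.Dart.edge

/-- Both ends of a path edge are vertices of the path, whereas inner vertices of a segment are not;
so a segment with a path edge consists of that edge alone. -/
theorem IsSegment.isArc_or {a b : G.Dart} {p S : List G.Dart}
    (hp : M.IsDualPath (M.tail a) p (M.tail b))
    (hS : M.IsSegment (M.tail a :: p.map M.head) S) :
    (∀ d ∈ S, d.edge ∈ p.map SimpleGraph.Dart.edge) ∨ ∃ x y, M.IsArc a p S x y := by
  by_cases hon : ∃ d ∈ S, d.edge ∈ p.map SimpleGraph.Dart.edge
  · left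
    obtain ⟨d, hd, hdp⟩ := hon
    have hends := hp.1.tail_mem_and_head_mem hdp
    cases S with
    | nil => simp at hd
    | cons x S =>
      rcases List.mem_cons.1 hd with rfl | hd
      · cases S with
        | nil => simpa using hdp
        | cons z S => exact absurd hends.2 (hS.2.2 d (by simp))
      · exact absurd hends.1 (hS.tail_notMem hd)
  · right
    push Not at hon
    refine ⟨S.head hS.1, S.getLast hS.1, hS, ⟨S.tail, ?_⟩, ⟨S.dropLast, ?_⟩, hon⟩
    · rw [List.cons_head_tail]
    · rw [List.dropLast_append_getLast]

/-! ### Parity of an arc as a change of sides -/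

section Arc

variable {a b x y : G.Dart} {p A : List G.Dart}

theorem IsArc.tail_first_mem (h : M.IsArc a p A x y) : M.tail x ∈ M.tail a :: p.map M.head := by
  obtain ⟨⟨-, ⟨u, hu, v, -, hw⟩, -⟩, ⟨A', rfl⟩, -, -⟩ := h
  rwa [hw.1]

theorem IsArc.head_last_mem (h : M.IsArc a p A x y) : M.head y ∈ M.tail a :: p.map M.head := by
  obtain ⟨⟨-, ⟨u, -, v, hv, hw⟩, -⟩, -, ⟨A', rfl⟩, -⟩ := h
  obtain ⟨w, -, hw⟩ := isDualWalk_append.1 hw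
  rwa [show M.head y = v from hw.2]

theorem IsArc.first_notMem (h : M.IsArc a p A x y) : x.edge ∉ p.map SimpleGraph.Dart.edge := by
  obtain ⟨-, ⟨A', rfl⟩, -, h⟩ := h
  exact h x (by simp)

theorem IsArc.last_notMem (h : M.IsArc a p A x y) : y.edge ∉ p.map SimpleGraph.Dart.edge := by
  obtain ⟨-, -, ⟨A', rfl⟩, h⟩ := h
  exact h y (by simp)

theorem IsArc.eq_last (h : M.IsArc a p A x y) {d : G.Dart} (hd : d ∈ A)
    (hd' : M.head d ∈ M.tail a :: p.map M.head) : d = y := by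
  obtain ⟨hS, -, ⟨A', rfl⟩, -⟩ := h
  have := hS.2.2
  rw [List.dropLast_concat] at this
  rcases List.mem_append.1 hd with hd | hd
  · exact absurd hd' (this d hd)
  · simpa using hd

theorem parity_eq_sum_add_sum (a b : G.Dart) (p W : List G.Dart) :
    M.parity a b p W = (W.map fun d => M.rightIndicator a b p d).sum +
      (W.map fun d => M.rightIndicator a b p d.symm).sum := by
  induction W with
  | nil => simp [parity]
  | cons x W ih =>
    rw [parity, List.map_cons, List.sum_cons, ← parity, ih]
    simp only [List.map_cons, List.sum_cons]
    ring

/-- Only the first dart and the reverse of the last one leave a vertex of the path. An arc is thus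
odd exactly when one of these two, and not the other, lies to the right. -/
theorem IsArc.parity_eq (h : M.IsArc a p A x y) :
    M.parity a b p A = M.rightIndicator a b p x + M.rightIndicator a b p y.symm := by
  rw [parity_eq_sum_add_sum]
  obtain ⟨hS, ⟨A₁, hA₁⟩, ⟨A₂, hA₂⟩, -⟩ := h
  congr 1
  · subst hA₁
    rw [List.map_cons, List.sum_cons, List.sum_eq_zero, add_zero]
    intro k hk
    obtain ⟨d, hd, rfl⟩ := List.mem_map.1 hk
    exact if_neg fun hr => hS.tail_notMem hd hr.tail_mem
  · subst hA₂
    rw [List.map_append, List.sum_append, List.sum_eq_zero, zero_add]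
    · simp
    · intro k hk
      obtain ⟨d, hd, rfl⟩ := List.mem_map.1 hk
      refine if_neg fun hr => hS.2.2 d ?_ hr.tail_mem
      rwa [List.dropLast_concat]

theorem parity_eq_zero_of_mem [Finite G.Dart] (hp : M.IsDualPath (M.tail a) p (M.tail b))
    {P : List G.Dart} (hP : ∀ d ∈ P, d.edge ∈ p.map SimpleGraph.Dart.edge) :
    M.parity a b p P = 0 := by
  apply parity_eq_zero
  intro d hd
  refine ⟨fun h => (h.notMem (z := d) hp rfl).1 (hP d hd), fun h => ?_⟩
  have := (h.notMem (z := d) hp rfl).1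
  rw [SimpleGraph.Dart.edge_symm] at this
  exact this (hP d hd)

/-- Distinct corners matter for the trivial path: if they agreed, both sectors would be empty. -/
theorem liesLeft_iff_not_liesRight [Finite G.Dart] (hab : a ≠ b)
    (hp : M.IsDualPath (M.tail a) p (M.tail b)) {d : G.Dart}
    (hd : M.tail d ∈ M.tail a :: p.map M.head) (hdp : d.edge ∉ p.map SimpleGraph.Dart.edge) :
    M.LiesLeft a b p d ↔ ¬ M.LiesRight a b p d :=
  liesLeft_iff_not_liesRight_aux hp rfl (Or.inl ⟨rfl, hab⟩) hd hdp

end Arc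

/-! ### Counting crossings -/

/-- Since `e` occurs once in `C`, a stretch of the cyclic list that starts with `e` is determined by
its length. -/
theorem prefix_of_cons_infix_append_self {α : Type*} {C β γ l : List α} {e : α}
    (hC : C.Nodup) (hdec : C = β ++ e :: γ) (h : e :: l <:+: C ++ C) : l <+: γ ++ C := by
  have huniq : ∀ β' γ', C = β' ++ e :: γ' → γ' = γ := by
    intro β' γ' h'
    rw [hdec, List.nodup_middle, List.nodup_cons, List.mem_append, not_or] at hC
    rw [hdec] at h'
    exact ((List.append_cons_inj_of_notMem hC.1.1 hC.1.2).1 h').2.2.symm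
  obtain ⟨s, t, hst⟩ := h
  rw [List.append_assoc, List.append_eq_append_iff] at hst
  -- The stretch begins in the first copy of `C` (or, for `r = []`, at the very start of the
  -- second), or else in the second copy.
  rcases hst with ⟨r, hr, hr'⟩ | ⟨r, hr, hr'⟩
  · cases r with
    | nil =>
      have := huniq [] (l ++ t) (by simpa using hr'.symm)
      rw [← this]
      exact (List.prefix_append l t).trans (List.prefix_append _ _)
    | cons z r =>
      rw [List.cons_append, List.cons_append, List.cons.injEq] at hr'
      obtain ⟨rfl, hr'⟩ := hr'
      rw [huniq s r hr] at hr'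
      exact ⟨t, hr'⟩
  · have := huniq r (l ++ t) (by simpa using hr')
    rw [← this]
    exact (List.prefix_append l t).trans (List.prefix_append _ _)

/-- Both `m` and `P` are the maximal initial run on which `q` holds. -/
theorem eq_of_append_singleton_prefix {α : Type*} {q : α → Prop} {m P γ : List α} {x y : α}
    (h : m ++ [x] <+: P ++ y :: γ) (hm : ∀ d ∈ m, q d) (hP : ∀ d ∈ P, q d) (hx : ¬ q x)
    (hy : ¬ q y) : m = P ∧ x = y := by
  induction m generalizing P with
  | nil =>
    cases P with
    | nil => simpa using h
    | cons z P =>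
      have : x = z := by simpa using h
      exact absurd (hP z (by simp)) (this ▸ hx)
  | cons w m ih =>
    cases P with
    | nil =>
      have : w = y := by
        rw [List.cons_append, List.nil_append, List.cons_prefix_cons] at h
        exact h.1
      exact absurd (hm w (by simp)) (this ▸ hy)
    | cons z P =>
      rw [List.cons_append, List.cons_append, List.cons_prefix_cons] at h
      obtain ⟨h1, h2⟩ := ih h.2 (fun d hd => hm d (by simp [hd])) (fun d hd => hP d (by simp [hd]))
      exact ⟨by rw [h.1, h1], h2⟩

section Crossing

variable [Finite G.Dart] {a b : G.Dart} {p : List G.Dart}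

/-- Two darts leave the path to opposite sides. -/
def OppositeSides (M : PlaneEmbedding G) (a b : G.Dart) (p : List G.Dart) (d d' : G.Dart) : Prop :=
  (M.LiesLeft a b p d ∧ M.LiesRight a b p d') ∨ (M.LiesRight a b p d ∧ M.LiesLeft a b p d')

theorem OppositeSides.left_mem (hp : M.IsDualPath (M.tail a) p (M.tail b)) {d d' : G.Dart}
    (h : M.OppositeSides a b p d d') :
    M.tail d ∈ M.tail a :: p.map M.head ∧ d.edge ∉ p.map SimpleGraph.Dart.edge := by
  rcases h with h | h
  · exact ⟨h.1.tail_mem hp.1, (h.1.notMem hp rfl).1⟩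
  · exact ⟨h.1.tail_mem, (h.1.notMem (z := d) hp rfl).1⟩

theorem OppositeSides.right_notMem (hp : M.IsDualPath (M.tail a) p (M.tail b)) {d d' : G.Dart}
    (h : M.OppositeSides a b p d d') : d'.edge ∉ p.map SimpleGraph.Dart.edge := by
  rcases h with h | h
  · exact (h.2.notMem (z := d) hp rfl).1
  · exact (h.2.notMem hp rfl).1

theorem oppositeSides_iff (hab : a ≠ b) (hp : M.IsDualPath (M.tail a) p (M.tail b))
    {d d' : G.Dart} (hd : M.tail d ∈ M.tail a :: p.map M.head)
    (hdp : d.edge ∉ p.map SimpleGraph.Dart.edge) (hd' : M.tail d' ∈ M.tail a :: p.map M.head)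
    (hdp' : d'.edge ∉ p.map SimpleGraph.Dart.edge) :
    M.OppositeSides a b p d d' ↔
      M.rightIndicator a b p d + M.rightIndicator a b p d' = 1 := by
  rw [OppositeSides, liesLeft_iff_not_liesRight hab hp hd hdp,
    liesLeft_iff_not_liesRight hab hp hd' hdp', rightIndicator, rightIndicator]
  by_cases h1 : M.LiesRight a b p d <;> by_cases h2 : M.LiesRight a b p d' <;> simp [h1, h2]

/-- A crossing starts with a dart that comes to the path from outside. -/
theorem IsCrossing.exists_first (hp : M.IsDualPath (M.tail a) p (M.tail b)) {C l : List G.Dart}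
    (h : M.IsCrossing a b p C l) : ∃ e l', l = e :: l' ∧ e ∈ C ∧
      M.head e ∈ M.tail a :: p.map M.head ∧ e.edge ∉ p.map SimpleGraph.Dart.edge := by
  obtain ⟨e, m, x, rfl, hinf, -, hside⟩ := h
  have h1 := OppositeSides.left_mem hp hside
  rw [tail_symm, SimpleGraph.Dart.edge_symm] at h1
  refine ⟨e, _, rfl, ?_, h1.1, h1.2⟩
  simpa using hinf.subset (List.mem_cons_self)

/-- The only candidate for a crossing that starts with a given dart of a cycle. -/
theorem isCrossing_cons_iff (hp : M.IsDualPath (M.tail a) p (M.tail b))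
    {C α P β γ l : List G.Dart} {e y : G.Dart} (hC : C.Nodup) (hdec : C = α ++ e :: (P ++ β))
    (hy : β ++ C = y :: γ) (hP : ∀ d ∈ P, d.edge ∈ p.map SimpleGraph.Dart.edge)
    (hyp : y.edge ∉ p.map SimpleGraph.Dart.edge) :
    M.IsCrossing a b p C (e :: l) ↔ l = P ++ [y] ∧ M.OppositeSides a b p e.symm y := by
  constructor
  · rintro ⟨e', m, x, hl, hinf, hm, hside⟩
    rw [List.cons.injEq] at hl
    obtain ⟨rfl, rfl⟩ := hl
    have h1 := prefix_of_cons_infix_append_self hC hdec hinf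
    rw [List.append_assoc, hy] at h1
    obtain ⟨rfl, rfl⟩ := eq_of_append_singleton_prefix
      (q := fun d : G.Dart => d.edge ∈ p.map SimpleGraph.Dart.edge) h1 hm hP
      (OppositeSides.right_notMem hp hside) hyp
    exact ⟨rfl, hside⟩
  · rintro ⟨rfl, hside⟩
    refine ⟨e, P, y, rfl, ⟨α, γ, ?_⟩, hP, hside⟩
    calc α ++ e :: (P ++ [y]) ++ γ = α ++ e :: (P ++ y :: γ) := by simp
      _ = (α ++ e :: (P ++ β)) ++ C := by rw [← hy]; simp
      _ = C ++ C := by rw [← hdec]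

/-- A cycle made of an odd arc and a stretch of the path crosses the path once. -/
theorem crossingNumber_arc_append (hab : a ≠ b) (hp : M.IsDualPath (M.tail a) p (M.tail b))
    {A P : List G.Dart} {x y : G.Dart} (hA : M.IsArc a p A x y) (hodd : M.parity a b p A = 1)
    (hP : ∀ d ∈ P, d.edge ∈ p.map SimpleGraph.Dart.edge) (hnd : (A ++ P).Nodup) :
    M.crossingNumber a b p (A ++ P) = 1 := by
  obtain ⟨-, ⟨A₁, hA₁⟩, ⟨A₂, hA₂⟩, -⟩ := id hA
  -- The cycle comes back to the path along `y`, follows `P`, and leaves along `x`. The sides differ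
  -- because the arc is odd.
  have hside : M.OppositeSides a b p y.symm x := by
    rw [oppositeSides_iff hab hp (by simpa using hA.head_last_mem) (by simpa using hA.last_notMem)
      hA.tail_first_mem hA.first_notMem, add_comm, ← hA.parity_eq, hodd]
  have hiff : ∀ l, M.IsCrossing a b p (A ++ P) (y :: l) ↔
      l = P ++ [x] ∧ M.OppositeSides a b p y.symm x := fun l =>
    isCrossing_cons_iff hp (α := A₂) (β := []) (γ := A₁ ++ P) hnd (by simp [hA₂])
      (by simp [hA₁]) hP hA.first_notMem
  rw [crossingNumber, Set.ncard_eq_one]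
  refine ⟨y :: (P ++ [x]), ?_⟩
  ext l
  rw [Set.mem_ofPred_eq, Set.mem_singleton_iff]
  constructor
  · intro h
    obtain ⟨e, l', rfl, heC, heF, hep⟩ := h.exists_first hp
    rcases List.mem_append.1 heC with he | he
    · obtain rfl := hA.eq_last he heF
      rw [((hiff l').1 h).1]
    · exact absurd (hP e he) hep
  · rintro rfl
    exact (hiff _).2 ⟨rfl, hside⟩

/-- A cycle made of an odd arc, an even arc and two stretches of the path crosses the path once. -/
theorem crossingNumber_arc_append_arc_append (hab : a ≠ b)
    (hp : M.IsDualPath (M.tail a) p (M.tail b)) {A P B Q : List G.Dart} {x y z w : G.Dart}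
    (hA : M.IsArc a p A x y) (hodd : M.parity a b p A = 1)
    (hB : M.IsArc a p B z w) (heven : M.parity a b p B = 0)
    (hP : ∀ d ∈ P, d.edge ∈ p.map SimpleGraph.Dart.edge)
    (hQ : ∀ d ∈ Q, d.edge ∈ p.map SimpleGraph.Dart.edge) (hnd : (A ++ P ++ B ++ Q).Nodup) :
    M.crossingNumber a b p (A ++ P ++ B ++ Q) = 1 := by
  obtain ⟨-, ⟨A₁, hA₁⟩, ⟨A₂, hA₂⟩, -⟩ := id hA
  obtain ⟨-, ⟨B₁, hB₁⟩, ⟨B₂, hB₂⟩, -⟩ := id hB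
  -- The junctions along `P` and `Q` use the same four dart ends as the two arcs. Mod 2, the numbers
  -- of side changes add up to the total parity `1`, so exactly one junction is a crossing.
  have hsum : M.OppositeSides a b p y.symm z ↔ ¬ M.OppositeSides a b p w.symm x := by
    rw [oppositeSides_iff hab hp (by simpa using hA.head_last_mem) (by simpa using hA.last_notMem)
      hB.tail_first_mem hB.first_notMem, oppositeSides_iff hab hp (by simpa using hB.head_last_mem)
      (by simpa using hB.last_notMem) hA.tail_first_mem hA.first_notMem]
    rw [hA.parity_eq] at hodd
    rw [hB.parity_eq] at heven
    generalize M.rightIndicator a b p x = k₁ at *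
    generalize M.rightIndicator a b p y.symm = k₂ at *
    generalize M.rightIndicator a b p z = k₃ at *
    generalize M.rightIndicator a b p w.symm = k₄ at *
    revert k₁ k₂ k₃ k₄
    decide
  have hiffA : ∀ l, M.IsCrossing a b p (A ++ P ++ B ++ Q) (y :: l) ↔
      l = P ++ [z] ∧ M.OppositeSides a b p y.symm z := fun l =>
    isCrossing_cons_iff hp (α := A₂) (β := B ++ Q) (γ := B₁ ++ Q ++ (A ++ P ++ B ++ Q)) hnd
      (by simp [hA₂]) (by simp [hB₁]) hP hB.first_notMem
  have hiffB : ∀ l, M.IsCrossing a b p (A ++ P ++ B ++ Q) (w :: l) ↔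
      l = Q ++ [x] ∧ M.OppositeSides a b p w.symm x := fun l =>
    isCrossing_cons_iff hp (α := A ++ P ++ B₂) (β := []) (γ := A₁ ++ P ++ B ++ Q) hnd
      (by simp [hB₂]) (by simp [hA₁]) hQ hA.first_notMem
  have hfirst : ∀ l, M.IsCrossing a b p (A ++ P ++ B ++ Q) l →
      (l = y :: (P ++ [z]) ∧ M.OppositeSides a b p y.symm z) ∨
        (l = w :: (Q ++ [x]) ∧ M.OppositeSides a b p w.symm x) := by
    intro l h
    obtain ⟨e, l', rfl, heC, heF, hep⟩ := h.exists_first hp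
    simp only [List.mem_append] at heC
    rcases heC with ((he | he) | he) | he
    · obtain rfl := hA.eq_last he heF
      have := (hiffA l').1 h
      exact Or.inl ⟨by rw [this.1], this.2⟩
    · exact absurd (hP e he) hep
    · obtain rfl := hB.eq_last he heF
      have := (hiffB l').1 h
      exact Or.inr ⟨by rw [this.1], this.2⟩
    · exact absurd (hQ e he) hep
  rw [crossingNumber, Set.ncard_eq_one]
  by_cases hside : M.OppositeSides a b p y.symm z
  · refine ⟨y :: (P ++ [z]), ?_⟩
    ext l
    rw [Set.mem_ofPred_eq, Set.mem_singleton_iff]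
    refine ⟨fun h => ?_, ?_⟩
    · rcases hfirst l h with h | h
      · exact h.1
      · exact absurd h.2 (hsum.1 hside)
    · rintro rfl
      exact (hiffA _).2 ⟨rfl, hside⟩
  · refine ⟨w :: (Q ++ [x]), ?_⟩
    ext l
    rw [Set.mem_ofPred_eq, Set.mem_singleton_iff]
    refine ⟨fun h => ?_, ?_⟩
    · rcases hfirst l h with h | h
      · exact absurd h.2 hside
      · exact h.1
    · rintro rfl
      exact (hiffB _).2 ⟨rfl, not_not.1 fun h => hside (hsum.2 h)⟩

end Crossing

theorem IsMinSeparatingCycle.nodup {c : Sym2 V → ℝ} {s t : V} {C : List G.Dart}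
    (h : M.IsMinSeparatingCycle c s t C) : C.Nodup :=
  h.1.1.2.2.1.of_map _

/-- A closed walk of odd parity can be cut into segments if it is started at a suitable vertex. -/
theorem exists_segments_of_parity {a b : G.Dart} {p : List G.Dart} {f : M.Face} {C : List G.Dart}
    (hC : M.IsDualWalk f C f) (hpar : M.parity a b p C = 1) :
    ∃ (h : M.Face) (L : List (List G.Dart)), M.IsDualWalk h L.flatten h ∧ L.flatten.Perm C ∧
      ∀ S ∈ L, M.IsSegment (M.tail a :: p.map M.head) S := by
  -- A walk that misses every vertex of the path has no dart end to its right, hence parity zero.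
  obtain ⟨h, hhC, hhF⟩ : ∃ h, h ∈ f :: C.map M.head ∧ h ∈ M.tail a :: p.map M.head := by
    by_contra hcon
    push Not at hcon
    have : M.parity a b p C = 0 := by
      apply parity_eq_zero
      intro x hx
      have hx' := hC.tail_mem_and_head_mem (List.mem_map_of_mem hx)
      exact ⟨fun h => hcon _ hx'.1 h.tail_mem, fun h => hcon _ hx'.2 h.tail_mem⟩
    rw [this] at hpar
    exact zero_ne_one hpar
  obtain ⟨q, r, rfl, hq, hr, -⟩ := hC.exists_split hhC
  have hW := hr.append hq
  obtain ⟨L, hL, hseg⟩ := hW.exists_segments hhF hhF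
  rw [hL] at hW
  exact ⟨h, L, hW, hL ▸ List.perm_append_comm, hseg⟩

theorem parity_perm {a b : G.Dart} {p W W' : List G.Dart} (h : W.Perm W') :
    M.parity a b p W = M.parity a b p W' :=
  (h.map _).sum_eq

theorem length_perm (c : Sym2 V → ℝ) {W W' : List G.Dart} (h : W.Perm W') :
    M.length c W = M.length c W' :=
  (h.map _).sum_eq

theorem exists_odd_of_parity_flatten {a b : G.Dart} {p : List G.Dart} {L : List (List G.Dart)}
    (h : M.parity a b p L.flatten = 1) : ∃ S ∈ L, M.parity a b p S = 1 := by
  induction L with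
  | nil => simp [parity] at h
  | cons S L ih =>
    rw [List.flatten_cons, parity_append] at h
    have h01 : ∀ k l : ZMod 2, k + l = 1 → k = 1 ∨ l = 1 := by decide
    rcases h01 _ _ h with h | h
    · exact ⟨S, by simp, h⟩
    · obtain ⟨T, hT, hT'⟩ := ih h
      exact ⟨T, by simp [hT], hT'⟩

end PlaneEmbedding

/-! ### The exchange argument -/

open PlaneEmbedding in
theorem lemma1 {V : Type*} [Finite V] (G : SimpleGraph V) (hG : G.Connected)
    (M : PlaneEmbedding G) (c : Sym2 V → ℝ) (hc : ∀ e ∈ G.edgeSet, 0 < c e)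
    (s t : V) (hst : s ≠ t) (a b : G.Dart) (ha : a.fst = s) (hb : b.fst = t)
    (p : List G.Dart) (hp : M.IsShortestDualPath c (M.tail a) p (M.tail b))
    (C : List G.Dart) (hC : M.IsMinSeparatingCycle c s t C)
    (e : Sym2 V) (he : e ∈ C.map SimpleGraph.Dart.edge) :
    ∃ C' : List G.Dart, M.IsMinSeparatingCycle c s t C' ∧
      e ∈ C'.map SimpleGraph.Dart.edge ∧ M.crossingNumber a b p C' = 1 := by
  subst ha hb
  have : Finite G.Dart := Finite.of_injective _ SimpleGraph.Dart.toProd_injective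
  have : Fintype G.Dart := Fintype.ofFinite _
  have hab : a ≠ b := fun h => hst (by rw [h])
  have hpath := hp.1
  have hpar := hC.1.parity_eq_one hG hpath
  obtain ⟨f, hf⟩ := hC.1.1.2.1
  obtain ⟨h, L, hL, hperm, hseg⟩ := exists_segments_of_parity hf hpar
  have heL : e ∈ L.flatten.map SimpleGraph.Dart.edge := ((hperm.map _).mem_iff).2 he
  have hlen := M.length_perm c hperm
  rw [← parity_perm hperm] at hpar
  -- an odd segment, which contains the given edge if possible
  obtain ⟨A, hAL, hodd, hAe⟩ : ∃ A ∈ L, M.parity a b p A = 1 ∧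
      (e ∈ A.map SimpleGraph.Dart.edge ∨
        ∀ B ∈ L, e ∈ B.map SimpleGraph.Dart.edge → M.parity a b p B = 0) := by
    by_cases hex : ∃ A ∈ L, M.parity a b p A = 1 ∧ e ∈ A.map SimpleGraph.Dart.edge
    · obtain ⟨A, h1, h2, h3⟩ := hex
      exact ⟨A, h1, h2, Or.inl h3⟩
    · push Not at hex
      obtain ⟨A, h1, h2⟩ := exists_odd_of_parity_flatten hpar
      have h01 : ∀ k : ZMod 2, k ≠ 1 → k = 0 := by decide
      exact ⟨A, h1, h2, Or.inr fun B hB heB => h01 _ fun hB1 => hex B hB hB1 heB⟩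
  have hAseg := hseg A hAL
  obtain ⟨x, y, hA⟩ : ∃ x y, M.IsArc a p A x y := by
    refine (hAseg.isArc_or hpath).resolve_left fun hon => ?_
    rw [parity_eq_zero_of_mem hpath hon] at hodd
    exact zero_ne_one hodd
  obtain ⟨u, hu, v, hv, hAw⟩ := hAseg.2.1
  obtain ⟨L₁, L₂, rfl⟩ := List.append_of_mem hAL
  rw [List.flatten_append, List.flatten_cons] at hL heL hlen
  obtain ⟨u', hL₁, hL'⟩ := isDualWalk_append.1 hL
  obtain ⟨v', hA', hL₂⟩ := isDualWalk_append.1 hL'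
  obtain ⟨rfl, rfl⟩ := hA'.ends_unique hAw hAseg.1
  -- The rest of the cycle, read from the end of `A` round to its start.
  have hD : M.IsDualWalk v' (L₂ ++ L₁).flatten u' := by
    rw [List.flatten_append]
    exact hL₂.append hL₁
  have hDlen : M.length c A + M.length c (L₂ ++ L₁).flatten = M.length c C := by
    rw [← hlen, List.flatten_append]
    simp only [length_append]
    ring
  -- a closed walk that consists of the segment and a stretch of the path
  have hone : ∀ P, M.IsDualWalk v' P u' → (∀ d ∈ P, d.edge ∈ p.map SimpleGraph.Dart.edge) →
      M.length c P ≤ M.length c (L₂ ++ L₁).flatten →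
      M.IsMinSeparatingCycle c a.fst b.fst (A ++ P) ∧ M.crossingNumber a b p (A ++ P) = 1 := by
    intro P hP hPp hPlen
    have hmin : M.IsMinSeparatingCycle c a.fst b.fst (A ++ P) := by
      refine hC.of_parity hG hc hpath (hA'.append hP) ?_ ?_
      · rw [parity_append, hodd, parity_eq_zero_of_mem hpath hPp, add_zero]
      · rw [length_append]
        linarith
    exact ⟨hmin, crossingNumber_arc_append hab hpath hA hodd hPp hmin.nodup⟩
  by_cases heA : e ∈ A.map SimpleGraph.Dart.edge
  · obtain ⟨P, hP, hPp, hPmin⟩ := hp.exists_stretch hc hv hu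
    obtain ⟨h1, h2⟩ := hone P hP hPp (hPmin _ hD)
    exact ⟨A ++ P, h1, by rw [List.map_append]; exact List.mem_append_left _ heA, h2⟩
  · have heD : ∃ B ∈ L₂ ++ L₁, e ∈ B.map SimpleGraph.Dart.edge := by
      simp only [List.map_append, List.mem_append, List.map_flatten, List.mem_flatten,
        List.mem_map] at heL heA ⊢
      grind
    obtain ⟨B, hBL, heB⟩ := heD
    have hBL' : B ∈ L₁ ++ A :: L₂ := by
      simp only [List.mem_append, List.mem_cons] at hBL ⊢
      tauto
    have heven := hAe.resolve_left heA B hBL' heB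
    have hBseg := hseg B hBL'
    obtain ⟨z, hz, w, hw, hBw⟩ := hBseg.2.1
    obtain ⟨K₁, K₂, hK⟩ := List.append_of_mem hBL
    rw [hK, List.flatten_append, List.flatten_cons] at hD
    obtain ⟨z', hK₁, hK'⟩ := isDualWalk_append.1 hD
    obtain ⟨w', hB', hK₂⟩ := isDualWalk_append.1 hK'
    obtain ⟨rfl, rfl⟩ := hB'.ends_unique hBw hBseg.1
    -- `P` and `Q` replace the pieces `K₁` and `K₂` of the cycle between `A` and `B`.
    obtain ⟨P, hP, hPp, hPmin⟩ := hp.exists_stretch hc hv hz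
    obtain ⟨Q, hQ, hQp, hQmin⟩ := hp.exists_stretch hc hw hu
    have hPlen := hPmin _ hK₁
    have hQlen := hQmin _ hK₂
    have hKlen : M.length c K₁.flatten + M.length c B + M.length c K₂.flatten =
        M.length c (L₂ ++ L₁).flatten := by
      rw [hK, List.flatten_append, List.flatten_cons]
      simp only [length_append]
      ring
    have hmem : e ∈ (A ++ P ++ B ++ Q).map SimpleGraph.Dart.edge := by
      simp only [List.map_append, List.mem_append]
      tauto
    rcases hBseg.isArc_or hpath with hon | ⟨x', y', hB⟩
    · obtain ⟨h1, h2⟩ := hone (P ++ B ++ Q) ((hP.append hB').append hQ)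
        (by
          intro d hd
          simp only [List.mem_append] at hd
          rcases hd with (hd | hd) | hd
          · exact hPp d hd
          · exact hon d hd
          · exact hQp d hd)
        (by simp only [length_append]; linarith)
      rw [show A ++ (P ++ B ++ Q) = A ++ P ++ B ++ Q by simp] at h1 h2
      exact ⟨_, h1, hmem, h2⟩
    · have hmin : M.IsMinSeparatingCycle c a.fst b.fst (A ++ P ++ B ++ Q) := by
        refine hC.of_parity hG hc hpath (((hA'.append hP).append hB').append hQ) ?_ ?_
        · simp only [parity_append, hodd, heven, parity_eq_zero_of_mem hpath hPp,
            parity_eq_zero_of_mem hpath hQp, add_zero]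
        · simp only [length_append]
          linarith
      exact ⟨_, hmin, hmem, crossingNumber_arc_append_arc_append hab hpath hA hodd hB heven hPp
        hQp hmin.nodup⟩
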